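/- Let $r>1$, $n\ge 1$, let $p\ge 1$ divide $r$, and let $W=G(r,p,n)\subset GL_n(\mathbb C)$ be the group of monomial $n\times n$ matrices whose non-zero entries are $r$th roots of unity with product an $(r/p)$th root of unity. Let $\mathfrak h=\mathbb C^n$, let $x_1,\dots,x_n\in\mathfrak h^*$ be the coordinates, let $W$ act on $S=S(\mathfrak h^*)=\mathbb C[x_1,\dots,x_n]$ by $(wf)(y)=f(w^{-1}y)$, and let $J\subset S$ be the ideal generated by the $W$-invariants of positive degree. A $W$-module $V$ of finite dimension $l$ is called free if $(S\otimes\Lambda^\bullet V^*)^W$ is a free exterior algebra over $S^W$, that is, isomorphic to the exterior algebra of a free $S^W$-module of rank $l$ whose elements correspond to invariants in $S\otimes V^*$. The exponents of $V$ are the integers $e_1,\dots,e_l$ (with repetitions) defined by $$\sum_{i\ge 0}[(S/J)_i:V]\,t^i=\sum_{i=1}^{l}t^{e_i},\qquad [(S/J)_i:V]=\dim\operatorname{Hom}_W(V,(S/J)_i).$$ The degrees $d_1,\dots,d_n$ of $W$ are the degrees of algebraically independent homogeneous generators of $S^W$. Let $m$ be a positive integer not divisible by $r$, and let $V$ be the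 $W$-module $\mathbb C\{x_1^m,\dots,x_n^m\}\subset S$. Let $\overline m$ and $m'$ be the remainders of $m$ modulo $r$ and modulo $r/p$. Then: 1. $V$ is irreducible, except possibly when $n=2$, $p$ is even and $r\mid 2m$. 2. $V$ is free (in all cases, including the exceptional ones of 1). 3. The exponents of $V$ are $e_i=\overline m+(i-1)r$ for $1\le i\le n$ if $p=1$; if $p>1$ they are $e_i=\overline m+(i-1)r$ for $1\le i\le n-1$ together with $e_n=(n-1)(r-\overline m)+n m'$. 4. The degrees of $W$ are $r,2r,\dots,(n-1)r$ and $n(r/p)$. 5. Put $h=r(n-1)+r/p$ if $p<r$ and $h=r(n-1)$ if $p=r$. If $m=h+1$, then the multisets $\{h+1-e_i\}_{i=1}^n$ and $\{d_i\}_{i=1}^n$ are equal, where $e_1,\dots,e_n$ are the exponents of $V$ and $d_1,\dots,d_n$ the degrees of $W$. -/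

import Mathlib

open scoped TensorProduct

noncomputable section

namespace ReflRep

/-- The coordinate ring `S(𝔥*)` of `𝔥 = ℂⁿ`; the variable `X i` is the `i`-th coordinate `x_i`. -/
abbrev Poly (n : ℕ) : Type := MvPolynomial (Fin n) ℂ

/-- The action of `GL(𝔥)` on `S(𝔥*)` by algebra endomorphisms, `(w f)(y) = f(w⁻¹ y)`,
so that `w x_i = ∑ j, (w⁻¹) i j x_j`. -/
def polyAct (n : ℕ) : GL (Fin n) ℂ →* (Poly n →ₐ[ℂ] Poly n) where
  toFun w := MvPolynomial.aeval
    (fun i => ∑ j, ((w⁻¹ : GL (Fin n) ℂ) : Matrix (Fin n) (Fin n) ℂ) i j • MvPolynomial.X j)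
  map_one' := by
    apply MvPolynomial.algHom_ext
    intro i
    simp [Matrix.one_apply]
  map_mul' w v := by
    apply MvPolynomial.algHom_ext
    intro i
    simp only [MvPolynomial.aeval_X, AlgHom.mul_apply, map_sum, map_smul, mul_inv_rev,
      Units.val_mul, Matrix.mul_apply, Finset.sum_smul, Finset.smul_sum, smul_smul]
    rw [Finset.sum_comm]

/-- The `R`-algebra `A` is a free exterior algebra on `l` generators in the subset `M`: it is
isomorphic to the exterior algebra of the free module `R^l`, in such a way that `R^l` is mapped
into `M`. -/
def IsFreeExterior (R A : Type*) [CommRing R] [Ring A] [Algebra R A] (l : ℕ) (M : Set A) : Prop :=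
  ∃ φ : ExteriorAlgebra R (Fin l → R) ≃ₐ[R] A, ∀ v, φ (ExteriorAlgebra.ι R v) ∈ M

section General

variable {n : ℕ} (W : Subgroup (GL (Fin n) ℂ))

/-- `S(𝔥*)` as a representation of `W`. -/
def polyRep : Representation ℂ W (Poly n) where
  toFun w := (polyAct n w).toLinearMap
  map_one' := by ext; simp
  map_mul' w v := by ext; simp

/-- The invariant ring `S(𝔥*)^W`. -/
def invariantRing : Subalgebra ℂ (Poly n) where
  carrier := {f | ∀ w : W, polyAct n w f = f}
  mul_mem' ha hb w := by rw [map_mul, ha w, hb w]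
  add_mem' ha hb w := by rw [map_add, ha w, hb w]
  algebraMap_mem' c w := AlgHom.commutes _ c

/-- The numbers in the multiset `D` are the degrees of `W`: `S(𝔥*)^W` is generated by
algebraically independent homogeneous polynomials `f_1, …, f_n` whose degrees form `D`. -/
def IsDegrees (D : Multiset ℕ) : Prop :=
  ∃ (f : Fin n → Poly n) (d : Fin n → ℕ),
    (∀ i, (f i).IsHomogeneous (d i)) ∧
    AlgebraicIndependent ℂ f ∧
    Algebra.adjoin ℂ (Set.range f) = invariantRing W ∧
    D = Finset.univ.val.map d

/-- The ideal `J` of `S(𝔥*)` generated by the invariants of positive degree. -/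
def hilbertIdeal : Ideal (Poly n) :=
  Ideal.span {f | f ∈ invariantRing W ∧ ∃ d : ℕ, 0 < d ∧ f.IsHomogeneous d}

lemma hilbertIdeal_stable (w : W) :
    (hilbertIdeal W).restrictScalars ℂ ≤
      ((hilbertIdeal W).restrictScalars ℂ).comap (polyRep W w) := by
  intro f hf
  have h : hilbertIdeal W ≤ (hilbertIdeal W).comap (polyAct n w) := by
    refine Ideal.span_le.2 fun g hg => ?_
    change polyAct n w g ∈ hilbertIdeal W
    rw [hg.1 w]
    exact Ideal.subset_span hg
  exact h hf

/-- The coinvariant algebra `S(𝔥*)/J` as a representation of `W`. -/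
def coinvRep : Representation ℂ W (Poly n ⧸ (hilbertIdeal W).restrictScalars ℂ) :=
  (polyRep W).quotient _ (hilbertIdeal_stable W)

lemma isHomogeneous_polyAct (w : GL (Fin n) ℂ) {f : Poly n} {i : ℕ} (hf : f.IsHomogeneous i) :
    (polyAct n w f).IsHomogeneous i := by
  have h := hf.aeval (fun i => ∑ j, ((w⁻¹ : GL (Fin n) ℂ) : Matrix (Fin n) (Fin n) ℂ) i j •
    (MvPolynomial.X j : Poly n)) (n := 1) (fun k => MvPolynomial.IsHomogeneous.sum _ _ _
      fun j _ => by
        rw [MvPolynomial.smul_eq_C_mul]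
        exact (MvPolynomial.isHomogeneous_X ℂ j).C_mul _)
  rw [one_mul] at h
  exact h

/-- The `i`-th graded piece `(S(𝔥*)/J)_i`, as a subrepresentation of `S(𝔥*)/J`. -/
def coinvPiece (i : ℕ) : Subrepresentation (coinvRep W) where
  toSubmodule := (MvPolynomial.homogeneousSubmodule (Fin n) ℂ i).map
    ((hilbertIdeal W).restrictScalars ℂ).mkQ
  apply_mem_toSubmodule w v := by
    rintro ⟨f, hf, rfl⟩
    exact ⟨polyAct n w f, isHomogeneous_polyAct (w : GL (Fin n) ℂ) hf, rfl⟩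

variable {V : Type*} [AddCommGroup V] [Module ℂ V] (ρ : Representation ℂ W V)

/-- The multiplicity `[(S(𝔥*)/J)_i : V] = dim Hom_W(V, (S(𝔥*)/J)_i)`. -/
def coinvMult (i : ℕ) : ℕ :=
  Module.finrank ℂ (Representation.IntertwiningMap ρ (coinvPiece W i).toRepresentation)

/-- The numbers in the multiset `E` are the exponents of `V`:
`∑ i, [(S(𝔥*)/J)_i : V] t^i = ∑ e ∈ E, t^e`. -/
def IsExponents (E : Multiset ℕ) : Prop :=
  (PowerSeries.mk fun i => coinvMult W ρ i) =
    (E.map fun e => (PowerSeries.X : PowerSeries ℕ) ^ e).sum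

/-- The algebra `S(𝔥*) ⊗ Λ* V*`. -/
abbrev Forms (n : ℕ) (V : Type*) [AddCommGroup V] [Module ℂ V] : Type _ :=
  Poly n ⊗[ℂ] ExteriorAlgebra ℂ (Module.Dual ℂ V)

/-- The diagonal action of `w` on `S(𝔥*) ⊗ Λ* V*`, by algebra endomorphisms. -/
def formsAct (w : W) : Forms n V →ₐ[ℂ] Forms n V :=
  Algebra.TensorProduct.map (polyAct n w) (ExteriorAlgebra.map (ρ.dual w))

lemma formsAct_smul (w : W) (c : invariantRing W) (a : Forms n V) :
    formsAct W ρ w (c • a) = c • formsAct W ρ w a := by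
  have h : ∀ b : Forms n V, c • b = ((c : Poly n) ⊗ₜ[ℂ] 1) * b := by
    intro b
    induction b using TensorProduct.induction_on with
    | zero => simp
    | tmul x y => simp [Algebra.TensorProduct.tmul_mul_tmul, TensorProduct.smul_tmul',
        Subalgebra.smul_def]
    | add x y hx hy => rw [smul_add, hx, hy, mul_add]
  rw [h, h, map_mul]
  congr 1
  simp [formsAct, c.2 w]

/-- The invariants `(S(𝔥*) ⊗ Λ* V*)^W`, as an algebra over `S(𝔥*)^W`. -/
def invariantForms : Subalgebra (invariantRing W) (Forms n V) where
  carrier := {a | ∀ w : W, formsAct W ρ w a = a}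
  mul_mem' ha hb w := by rw [map_mul, ha w, hb w]
  add_mem' ha hb w := by rw [map_add, ha w, hb w]
  algebraMap_mem' c w := by
    rw [Algebra.algebraMap_eq_smul_one, formsAct_smul, map_one]

/-- The subspace `S(𝔥*) ⊗ V*` of forms of exterior degree one. -/
def oneForms (n : ℕ) (V : Type*) [AddCommGroup V] [Module ℂ V] : Submodule ℂ (Forms n V) :=
  LinearMap.range (TensorProduct.map (LinearMap.id : Poly n →ₗ[ℂ] Poly n)
    (ExteriorAlgebra.ι ℂ : Module.Dual ℂ V →ₗ[ℂ] _))

/-- `V` is free: `(S(𝔥*) ⊗ Λ* V*)^W` is a free exterior algebra over `S(𝔥*)^W`, on `dim V`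
generators of exterior degree one. -/
def IsFreeRep : Prop :=
  IsFreeExterior (invariantRing W) (invariantForms W ρ) (Module.finrank ℂ V)
    {ω | (ω : Forms n V) ∈ oneForms n V}

end General

section Grpn

/-- The group `G(r,p,n)` (for `p ∣ r`): monomial matrices whose non-zero entries are `r`-th roots
of unity with product an `r/p`-th root of unity. The column `j` has its only non-zero entry `a j`
in row `σ j`. -/
def G (r p n : ℕ) : Subgroup (GL (Fin n) ℂ) where
  carrier := {w | ∃ (σ : Equiv.Perm (Fin n)) (a : Fin n → ℂˣ),
    (∀ i, a i ^ r = 1) ∧ (∏ i, a i) ^ (r / p) = 1 ∧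
    ∀ i j, (w : Matrix (Fin n) (Fin n) ℂ) i j = if i = σ j then (a j : ℂ) else 0}
  one_mem' := ⟨1, fun _ => 1, by simp, by simp, fun i j => by simp [Matrix.one_apply]; congr⟩
  mul_mem' := by
    rintro w v ⟨σ, a, ha, ha', hw⟩ ⟨τ, b, hb, hb', hv⟩
    refine ⟨σ * τ, fun j => a (τ j) * b j, fun i => ?_, ?_, fun i j => ?_⟩
    · rw [mul_pow, ha, hb, one_mul]
    · rw [Finset.prod_mul_distrib, Equiv.prod_comp τ a, mul_pow, ha', hb', one_mul]
    · simp [Matrix.mul_apply, hw, hv]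
      congr
  inv_mem' := by
    rintro w ⟨σ, a, ha, ha', hw⟩
    refine ⟨σ⁻¹, fun j => (a (σ⁻¹ j))⁻¹, fun i => ?_, ?_, ?_⟩
    · rw [inv_pow, ha, inv_one]
    · rw [Equiv.prod_comp σ⁻¹ (fun j => (a j)⁻¹), Finset.prod_inv_distrib, inv_pow, ha', inv_one]
    · have h : (w : Matrix (Fin n) (Fin n) ℂ) *
          Matrix.of (fun i j => if i = σ⁻¹ j then (((a (σ⁻¹ j))⁻¹ : ℂˣ) : ℂ) else 0) = 1 := by
        ext i j
        simp [Matrix.mul_apply, hw, Matrix.one_apply]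
      intro i j
      rw [Matrix.coe_units_inv, Matrix.inv_eq_right_inv h, Matrix.of_apply]

/-- The `G(r,p,n)`-representation `ℂ{x_1^m, …, x_n^m}`, a subrepresentation of `S(𝔥*)`. -/
def powerRep (r p n m : ℕ) : Subrepresentation (polyRep (G r p n)) where
  toSubmodule := Submodule.span ℂ (Set.range fun i : Fin n => (MvPolynomial.X i : Poly n) ^ m)
  apply_mem_toSubmodule w v hv := by
    obtain ⟨σ, a, -, -, hw⟩ := w⁻¹.2
    suffices h : Submodule.span ℂ (Set.range fun i : Fin n => (MvPolynomial.X i : Poly n) ^ m) ≤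
        (Submodule.span ℂ (Set.range fun i : Fin n => (MvPolynomial.X i : Poly n) ^ m)).comap
          (polyRep (G r p n) w) from h hv
    refine Submodule.span_le.2 ?_
    rintro _ ⟨i, rfl⟩
    have h : polyAct n w (MvPolynomial.X i) = (a (σ⁻¹ i) : ℂ) • MvPolynomial.X (σ⁻¹ i) := by
      have hw' : ∀ i j, (((w : GL (Fin n) ℂ)⁻¹ : GL (Fin n) ℂ) : Matrix (Fin n) (Fin n) ℂ) i j =
        if i = σ j then (a j : ℂ) else 0 := hw
      change MvPolynomial.aeval _ (MvPolynomial.X i) = _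
      rw [MvPolynomial.aeval_X, Finset.sum_eq_single (σ⁻¹ i)]
      · rw [hw']; simp
      · intro j _ hj
        rw [hw', if_neg, zero_smul]
        rintro rfl
        simp at hj
      · simp
    change polyAct n w (MvPolynomial.X i ^ m) ∈
      Submodule.span ℂ (Set.range fun i : Fin n => (MvPolynomial.X i : Poly n) ^ m)
    rw [map_pow, h, smul_pow]
    exact Submodule.smul_mem _ _ (Submodule.subset_span ⟨_, rfl⟩)

/-- The Coxeter number of `G(r,p,n)` (for `r > 1`). -/
def coxeterNumber (r p n : ℕ) : ℕ :=
  if p < r then r * (n - 1) + r / p else r * (n - 1)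

/-- The explicit exponents of `ℂ{x_1^m, …, x_n^m}`: `m̄ + (i-1) r` for `1 ≤ i ≤ n` if `p = 1`;
if `p > 1`, the same for `1 ≤ i ≤ n - 1`, and `(n-1)(r - m̄) + n m'` for `i = n`. Here `m̄` and
`m'` are the remainders of `m` modulo `r` and modulo `r/p`. -/
def explicitExponents (r p n m : ℕ) : Multiset ℕ :=
  if p = 1 then
    (Multiset.range n).map fun i => m % r + i * r
  else
    ((n - 1) * (r - m % r) + n * (m % (r / p))) ::ₘ
      (Multiset.range (n - 1)).map fun i => m % r + i * r

/-- The explicit degrees `r, 2r, …, (n-1)r, n(r/p)` of `G(r,p,n)` (the last one is `n` if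
`p = r`). -/
def explicitDegrees (r p n : ℕ) : Multiset ℕ :=
  (n * (r / p)) ::ₘ (Multiset.range (n - 1)).map fun i => (i + 1) * r

end Grpn

end ReflRep

end

/-! An element of `G r p n` sends `X i` to `a i • X (σ i)`, so it permutes the basis `X i ^ m` of V
up to the scalars `a i ^ m`. Equivariant maps V → S and invariant one-forms in S ⊗ V* are therefore
the same thing: tuples F with w F_j = a_j^m F_{σ j} (`IsCovariant`). Such tuples can be written
down, and they are the rows of `covMatrix`. With n = k + 1, k rows consist of the powers x_j^(m̄ +
ir), 0 ≤ i < k. The remaining row has entries (x_1⋯x_n)^s / x_j^(r - m̄) with s = r - m̄ + m', where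
r/p divides s. For p = 1 one has m' = m̄, and this row has the missing degree m̄ + kr, so p = 1
needs no separate treatment.

Multiplying column j by x_j^(r - m̄) turns the matrix into a Vandermonde matrix in the x_j^r with
rescaled first row, so its determinant is (x_1⋯x_n)^m' ∏_{i<j} (x_j^r - x_i^r) (`det_covMatrix`).
The reflections force every top coefficient of an invariant form to be divisible by exactly this
product (`IsSemiinvariant.prod_dvd`), and the quotient is invariant. By Solomon's argument the wedge
products of the rows are then a basis of the invariant forms over S^W (`isFreeRep_of_covForm`). In
exterior degree one the same argument is Cramer's rule: the rows are a basis of the covariants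
(`IsCovariant.exists_eq_sum`).

Averaging over the finite group lifts a homomorphism V → (S/J)_d to a covariant of degree d. Modulo
J only the constant terms of its coefficients survive, so the rows of degree d give a basis of
Hom_W(V, (S/J)_d) (`coinvMult_eq_card`), and the exponents are the row degrees.

Irreducibility holds because the diagonal subgroup acts on the lines of the x_i^m by distinct
characters and the permutations are transitive. The degrees come from explicit basic invariants, and
their uniqueness from Jacobians at the origin (`IsDegrees.unique`). The duality for m = h + 1 is
then arithmetic. -/

noncomputable section

namespace ReflRep

open MvPolynomial

/-! ### The monomial action on polynomials -/

/-- The scalars `a` are the non-zero entries of an element of `G(r,p,n)`. -/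
def IsEntries (r p : ℕ) {n : ℕ} (a : Fin n → ℂ) : Prop :=
  (∀ i, a i ^ r = 1) ∧ (∏ i, a i) ^ (r / p) = 1

/-- `w` maps each coordinate `x_i` to `a_i x_{σ i}`. -/
def ActsMonomially {n : ℕ} (w : GL (Fin n) ℂ) (σ : Equiv.Perm (Fin n)) (a : Fin n → ℂ) : Prop :=
  ∀ i, polyAct n w (X i) = a i • X (σ i)

lemma exists_actsMonomially {r p n : ℕ} {w : GL (Fin n) ℂ} (hw : w ∈ G r p n) :
    ∃ σ a, IsEntries r p a ∧ ActsMonomially w σ a := by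
  obtain ⟨σ, a, h1, h2, hw⟩ := (G r p n).inv_mem hw
  refine ⟨σ⁻¹, fun i => a (σ⁻¹ i), ⟨fun i => ?_, ?_⟩, fun i => ?_⟩
  · simpa using congrArg Units.val (h1 (σ⁻¹ i))
  · rw [Equiv.prod_comp σ⁻¹ (fun j => (a j : ℂ))]
    simpa using congrArg Units.val h2
  · change MvPolynomial.aeval _ (MvPolynomial.X i) = _
    rw [MvPolynomial.aeval_X, Finset.sum_eq_single (σ⁻¹ i)]
    · rw [hw]; simp
    · intro j _ hj
      rw [hw, if_neg, zero_smul]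
      rintro rfl
      simp at hj
    · simp

lemma exists_mem_actsMonomially {r p n : ℕ} (hr : r ≠ 0) (σ : Equiv.Perm (Fin n)) {a : Fin n → ℂ}
    (ha : IsEntries r p a) : ∃ w ∈ G r p n, ActsMonomially w σ a := by
  have h0 : ∀ i, a i ≠ 0 := fun i h => by
    have := ha.1 i
    simp [h, hr] at this
  have hσ : ∀ i j, i = σ⁻¹ j ↔ σ i = j := fun i j => by
    rw [Equiv.Perm.eq_inv_iff_eq]
  let A : Matrix (Fin n) (Fin n) ℂ := Matrix.of fun i j => if i = σ⁻¹ j then a (σ⁻¹ j) else 0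
  let B : Matrix (Fin n) (Fin n) ℂ := Matrix.of fun i j => if i = σ j then (a j)⁻¹ else 0
  have hAB : A * B = 1 := by
    ext i j
    simp [A, B, Matrix.mul_apply, Matrix.one_apply, h0]
  have hBA : B * A = 1 := mul_eq_one_comm.1 hAB
  let v : GL (Fin n) ℂ := ⟨A, B, hAB, hBA⟩
  refine ⟨v⁻¹, inv_mem ⟨σ⁻¹, fun j => Units.mk0 (a (σ⁻¹ j)) (h0 _), fun i => ?_, ?_, fun i j => ?_⟩,
    fun i => ?_⟩
  · ext; simpa using ha.1 _
  · ext
    rw [Equiv.prod_comp σ⁻¹ (fun j => Units.mk0 (a j) (h0 j))]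
    simpa using ha.2
  · rfl
  · change MvPolynomial.aeval _ (MvPolynomial.X i) = _
    rw [MvPolynomial.aeval_X, inv_inv, Finset.sum_eq_single (σ i)]
    · simp [v, A]
    · intro j _ hj
      rw [show ((v : Matrix (Fin n) (Fin n) ℂ)) i j = 0 from if_neg ?_, zero_smul]
      rw [hσ]; exact Ne.symm hj
    · simp

/-- Diagonal elements scale each monomial separately, so invariance conditions under them become
congruences on the exponents that occur. -/
lemma polyAct_monomial_of_diag {n : ℕ} {w : GL (Fin n) ℂ} {a : Fin n → ℂ}
    (hw : ActsMonomially w 1 a) (f : Poly n) (d : Fin n →₀ ℕ) :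
    coeff d (polyAct n w f) = (d.prod fun i e => a i ^ e) * coeff d f := by
  induction f using MvPolynomial.induction_on' with
  | monomial u c =>
    have : polyAct n w (monomial u c) = monomial u ((u.prod fun i e => a i ^ e) * c) := by
      rw [monomial_eq, monomial_eq, map_mul, Finsupp.prod, map_prod, Finsupp.prod]
      simp only [map_pow, hw _, smul_pow, Equiv.Perm.one_apply]
      rw [← algebraMap_eq, AlgHom.commutes, algebraMap_eq]
      simp only [smul_eq_C_mul, Finset.prod_mul_distrib, map_mul, map_prod]
      ring
    rw [this, coeff_monomial, coeff_monomial]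
    split_ifs with h
    · rw [h]
    · simp
  | add f g hf hg => rw [map_add, coeff_add, coeff_add, hf, hg, mul_add]

/-! ### Semi-invariants and the divisors forced by reflections -/

/-- The semi-invariants of `G(r,p,n)` whose product with the volume form of `V*` is invariant. -/
def IsSemiinvariant (r p m : ℕ) {n : ℕ} (h : Poly n) : Prop :=
  ∀ w ∈ G r p n, ∀ σ a, IsEntries r p a → ActsMonomially w σ a →
    polyAct n w h = ((Equiv.Perm.sign σ : ℤ) * (∏ i, a i) ^ m : ℂ) • h

lemma irreducible_of_isHomogeneous_one {n : ℕ} {f : Poly n} (hf : f.IsHomogeneous 1)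
    (h0 : f ≠ 0) : Irreducible f := by
  refine irreducible_of_totalDegree_eq_one (hf.totalDegree h0) fun c hc => ?_
  obtain ⟨d, hd⟩ := MvPolynomial.ne_zero_iff.1 h0
  exact isUnit_of_dvd_unit (hc d) (Ne.isUnit hd)

lemma irreducible_X_sub_C_mul_X {n : ℕ} {i j : Fin n} (hij : i ≠ j) (ζ : ℂ) :
    Irreducible (X j - C ζ * X i : Poly n) := by
  refine irreducible_of_isHomogeneous_one
    ((isHomogeneous_X ℂ j).sub ((isHomogeneous_X ℂ i).C_mul ζ)) fun h => ?_
  have := congrArg (MvPolynomial.eval (Pi.single j (1 : ℂ))) h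
  simp [hij] at this

/-- Factor theorem for a linear form: modulo `X j - C ζ * X i` the substitution `X j ↦ C ζ * X i` is
the identity, as one sees on the variables. -/
lemma X_sub_C_mul_X_dvd {n : ℕ} {i j : Fin n} {ζ : ℂ} {f : Poly n}
    (hf : aeval (fun l => if l = j then C ζ * X i else X l : Fin n → Poly n) f = 0) :
    X j - C ζ * X i ∣ f := by
  have h : ∀ g, X j - C ζ * X i ∣
      g - aeval (fun l => if l = j then C ζ * X i else X l : Fin n → Poly n) g := by
    intro g
    induction g using MvPolynomial.induction_on with
    | C c => simp [← algebraMap_eq]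
    | add g₁ g₂ h₁ h₂ => rw [map_add, add_sub_add_comm]; exact dvd_add h₁ h₂
    | mul_X g l hg =>
      rw [map_mul, aeval_X]
      split_ifs with hl
      · rw [hl, show ∀ a b c d : Poly n, a * b - c * d = (a - c) * d + a * (b - d) by
          intros; ring]
        exact dvd_add (hg.mul_right _) (dvd_mul_left _ _)
      · rw [← sub_mul]
        exact hg.mul_right _
  have := h f
  rwa [hf, sub_zero] at this

lemma X_pow_dvd_of_coeff {n : ℕ} {i : Fin n} {k : ℕ} {f : Poly n}
    (hf : ∀ d, coeff d f ≠ 0 → k ≤ d i) : X i ^ k ∣ f := by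
  rw [f.as_sum]
  refine Finset.dvd_sum fun d hd => ?_
  rw [X_pow_eq_monomial, monomial_dvd_monomial]
  exact ⟨Or.inr (by simpa using hf d (mem_support_iff.1 hd)), one_dvd _⟩

section Semiinvariant

variable {r p m n : ℕ} {h : Poly n}

/-- The diagonal element with the single entry ζ^p ≠ 1 at place i (trivial if p = r) multiplies the
monomial d by ζ^(p d_i) and h by ζ^(p m). As ζ^p has order r/p, this gives d_i ≡ m mod r/p. -/
lemma IsSemiinvariant.mod_le_of_coeff (hr : 0 < r) (hpr : p ∣ r) (hh : IsSemiinvariant r p m h)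
    (i : Fin n) {d : Fin n →₀ ℕ} (hd : coeff d h ≠ 0) : m % (r / p) ≤ d i := by
  set ζ := Complex.exp (2 * Real.pi * Complex.I / r)
  have hζ : IsPrimitiveRoot ζ r := Complex.isPrimitiveRoot_exp r hr.ne'
  have hζp : IsPrimitiveRoot (ζ ^ p) (r / p) := hζ.pow hr (Nat.mul_div_cancel' hpr).symm
  have hprod : ∏ l, Pi.mulSingle i (ζ ^ p) l = ζ ^ p := Fintype.prod_pi_mulSingle' _ _
  have ha : IsEntries r p (Pi.mulSingle i (ζ ^ p) : Fin n → ℂ) := by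
    refine ⟨fun l => ?_, by rw [hprod, hζp.pow_eq_one]⟩
    rw [Pi.mulSingle_apply]
    split_ifs
    · rw [pow_right_comm, hζ.pow_eq_one, one_pow]
    · simp
  obtain ⟨w, hw, hact⟩ := exists_mem_actsMonomially hr.ne' 1 ha
  have h1 := congrArg (coeff d) (hh w hw _ _ ha hact)
  rw [polyAct_monomial_of_diag hact, hprod, coeff_smul, smul_eq_mul] at h1
  have h2 := mul_right_cancel₀ hd h1
  rw [Finsupp.prod_fintype _ _ (by simp), Finset.prod_eq_single i
    (fun l _ hl => by simp [Pi.mulSingle_eq_of_ne hl]) (by simp)] at h2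
  simp only [Pi.mulSingle_eq_same, Equiv.Perm.sign_one, Units.val_one, Int.cast_one,
    one_mul] at h2
  have hq : r / p ≠ 0 := (Nat.div_pos (Nat.le_of_dvd hr hpr) (Nat.pos_of_dvd_of_pos hpr hr)).ne'
  rw [(hζp.isOfFinOrder hq).pow_inj_mod, ← hζp.eq_orderOf] at h2
  rw [← h2]
  exact Nat.mod_le _ _

/-- The reflection x_j ↦ ζ x_i, x_i ↦ ζ⁻¹ x_j has entries with product 1 and a transposition as
permutation, so it negates h. It fixes the hyperplane x_j = ζ x_i pointwise, so h equals its own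
negative there and vanishes. -/
lemma IsSemiinvariant.X_sub_dvd (hr : 0 < r) (hh : IsSemiinvariant r p m h)
    {i j : Fin n} (hij : i ≠ j) {ζ : ℂ} (hζ : ζ ^ r = 1) : X j - C ζ * X i ∣ h := by
  have h0 : ζ ≠ 0 := fun h => by simp [h, hr.ne'] at hζ
  apply X_sub_C_mul_X_dvd
  set φ : Poly n →ₐ[ℂ] Poly n := aeval (fun l => if l = j then C ζ * X i else X l)
  let a : Fin n → ℂ := fun l => if l = j then ζ else if l = i then ζ⁻¹ else 1
  have hprod : ∏ l, a l = 1 := by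
    rw [← Finset.prod_subset (Finset.subset_univ {j, i})]
    · rw [Finset.prod_pair hij.symm]
      simp [a, hij, h0]
    · intro l _ hl
      simp only [Finset.mem_insert, Finset.mem_singleton, not_or] at hl
      simp [a, hl]
  have ha : IsEntries r p a := by
    refine ⟨fun l => ?_, by simp [hprod]⟩
    simp only [a]
    split_ifs <;> simp [hζ]
  obtain ⟨w, hw, hact⟩ := exists_mem_actsMonomially hr.ne' (Equiv.swap i j) ha
  have h1 := congrArg φ (hh w hw _ _ ha hact)
  have h2 : φ.comp (polyAct n w) = φ := by
    apply MvPolynomial.algHom_ext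
    intro l
    rw [AlgHom.comp_apply, hact, map_smul]
    simp only [φ, aeval_X, a]
    by_cases hlj : l = j
    · simp [hlj, hij, smul_eq_C_mul]
    by_cases hli : l = i
    · simp [hli, hij, smul_eq_C_mul, ← mul_assoc, ← C_mul, h0]
    · simp [hlj, hli, Equiv.swap_apply_of_ne_of_ne]
  rw [← AlgHom.comp_apply, h2, hprod, Equiv.Perm.sign_swap hij, map_smul] at h1
  simp only [Units.val_neg, Units.val_one, Int.cast_neg, Int.cast_one, one_pow, mul_one, neg_smul,
    one_smul] at h1
  exact self_eq_neg.1 h1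

lemma X_pow_sub_X_pow_eq_prod (hr : 0 < r) (i j : Fin n) :
    (X j ^ r - X i ^ r : Poly n) =
      ∏ ζ ∈ Polynomial.nthRootsFinset r (1 : ℂ), (X j - C ζ * X i) := by
  have hζ := Complex.isPrimitiveRoot_exp r hr.ne'
  rw [(hζ.map_of_injective (C_injective (Fin n) ℂ)).pow_sub_pow_eq_prod_sub_mul _ _ hr]
  symm
  refine Finset.prod_nbij C (fun a ha => ?_) (fun a _ b _ hab => C_injective _ _ hab)
    (fun a ha => ?_) (fun _ _ => rfl)
  · rw [Polynomial.mem_nthRootsFinset hr] at ha ⊢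
    rw [← C_pow, ha, C_1]
  · rw [Finset.mem_coe, Polynomial.mem_nthRootsFinset hr] at ha
    -- A root of unity in the polynomial ring is a unit, hence a constant, so the factorization over
    -- polynomial roots of unity is one over complex ones.
    have hu : a.totalDegree = 0 := by
      have := IsUnit.of_pow_eq_one ha hr.ne'
      exact (isUnit_iff_totalDegree_of_isReduced.1 this).2
    obtain ⟨c, rfl⟩ : ∃ c, a = C c := ⟨_, totalDegree_eq_zero_iff_eq_C.1 hu⟩
    refine ⟨c, ?_, rfl⟩
    rw [Finset.mem_coe, Polynomial.mem_nthRootsFinset hr]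
    apply C_injective (Fin n) ℂ
    rw [C_pow, ha, C_1]

/-- The point with x_c = 0, x_j = ζ and all other coordinates 1 lies on the hyperplane x_j = ζ x_i,
but exactly one of x_k, x_l is zero there. So no linear factor of the first polynomial divides the
second. -/
lemma isRelPrime_X_pow_sub_X_pow (hr : 0 < r) {i j k l : Fin n} (hij : i ≠ j) (hkl : k ≠ l)
    {c : Fin n} (hc : c = k ∨ c = l) (hci : c ≠ i) (hcj : c ≠ j) :
    IsRelPrime (X j ^ r - X i ^ r : Poly n) (X l ^ r - X k ^ r) := by
  rw [X_pow_sub_X_pow_eq_prod hr i j]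
  refine IsRelPrime.prod_left fun ζ hζ => ?_
  rw [Polynomial.mem_nthRootsFinset hr] at hζ
  rw [(irreducible_X_sub_C_mul_X hij ζ).isRelPrime_iff_not_dvd]
  rintro ⟨g, hg⟩
  have h1 := congrArg (MvPolynomial.eval
    (fun a => if a = c then 0 else if a = j then ζ else 1 : Fin n → ℂ)) hg
  simp only [map_sub, map_pow, eval_X, map_mul, eval_C, hci.symm, hcj.symm, hij, if_true,
    if_false, mul_one, sub_self, zero_mul] at h1
  rcases hc with rfl | rfl
  · by_cases hlj : l = j
    · simp [hlj, hcj.symm, hr.ne', hζ] at h1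
    · simp [hlj, hkl.symm, hr.ne'] at h1
  · by_cases hlj : k = j
    · simp [hlj, hcj.symm, hr.ne', hζ] at h1
    · simp [hlj, hkl, hr.ne'] at h1

lemma irreducible_X (i : Fin n) : Irreducible (X i : Poly n) :=
  irreducible_of_isHomogeneous_one (isHomogeneous_X ℂ i) (X_ne_zero i)

lemma IsSemiinvariant.prod_dvd (hr : 0 < r) (hpr : p ∣ r) (hh : IsSemiinvariant r p m h) :
    (∏ i, X i) ^ (m % (r / p)) * ∏ i : Fin n, ∏ j ∈ Finset.Ioi i, (X j ^ r - X i ^ r) ∣ h := by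
  have hirr := irreducible_X (n := n)
  rw [← Finset.prod_pow, Finset.prod_sigma']
  refine IsRelPrime.mul_dvd ?_ ?_ ?_
  · refine IsRelPrime.prod_left fun c _ => IsRelPrime.prod_right fun x hx => ?_
    simp only [Finset.mem_sigma, Finset.mem_univ, Finset.mem_Ioi, true_and] at hx
    refine IsRelPrime.pow_left ?_
    rw [(hirr c).isRelPrime_iff_not_dvd]
    rintro ⟨g, hg⟩
    by_cases hc : c = x.2
    · have h1 := congrArg (MvPolynomial.eval (Pi.single x.1 (1 : ℂ))) hg
      simp [hc, hx.ne', hr.ne'] at h1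
    · have h1 := congrArg (MvPolynomial.eval (Pi.single x.2 (1 : ℂ))) hg
      simp [hc, hx.ne, hr.ne'] at h1
  · refine Fintype.prod_dvd_of_isRelPrime (fun c d hcd => ?_) fun c =>
      X_pow_dvd_of_coeff fun d hd => hh.mod_le_of_coeff hr hpr c hd
    refine IsRelPrime.pow ?_
    rw [(hirr c).isRelPrime_iff_not_dvd]
    rintro ⟨g, hg⟩
    have h1 := congrArg (MvPolynomial.eval (Pi.single d (1 : ℂ))) hg
    simp [hcd] at h1
  · refine Finset.prod_dvd_of_isRelPrime ?_ ?_
    · rintro ⟨i, j⟩ hx ⟨k, l⟩ hy hxy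
      simp only [Finset.coe_sigma, Set.mem_sigma_iff, Finset.mem_coe, Finset.mem_univ,
        Finset.mem_Ioi, true_and] at hx hy
      change IsRelPrime (X j ^ r - X i ^ r : Poly n) (X l ^ r - X k ^ r)
      by_cases hk : k ≠ i ∧ k ≠ j
      · exact isRelPrime_X_pow_sub_X_pow hr hx.ne hy.ne (Or.inl rfl) hk.1 hk.2
      by_cases hl : l ≠ i ∧ l ≠ j
      · exact isRelPrime_X_pow_sub_X_pow hr hx.ne hy.ne (Or.inr rfl) hl.1 hl.2
      -- Here both k and l lie in {i, j}; since i < j and k < l, the two pairs coincide.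
      exfalso
      simp only [ne_eq, Sigma.mk.injEq, heq_eq_eq] at hxy hx hy
      omega
    · rintro ⟨i, j⟩ hx
      simp only [Finset.mem_sigma, Finset.mem_univ, Finset.mem_Ioi, true_and] at hx
      change (X j ^ r - X i ^ r : Poly n) ∣ h
      rw [X_pow_sub_X_pow_eq_prod hr]
      refine Finset.prod_dvd_of_isRelPrime ?_ fun ζ hζ =>
        hh.X_sub_dvd hr hx.ne ((Polynomial.mem_nthRootsFinset hr _).1 hζ)
      intro ζ hζ ξ hξ hne
      change IsRelPrime (X j - C ζ * X i : Poly n) (X j - C ξ * X i)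
      rw [(irreducible_X_sub_C_mul_X hx.ne ζ).isRelPrime_iff_not_dvd]
      rintro ⟨g, hg⟩
      have h1 := congrArg (MvPolynomial.eval
        (fun a => if a = j then ζ else 1 : Fin n → ℂ)) hg
      simp [hx.ne, sub_eq_zero, hne] at h1

end Semiinvariant

/-! ### Covariants and the determinant of the basic ones -/

/-- The tuples `(f_1, …, f_n)` of polynomials such that `∑ j, f_j ⊗ y_j` is invariant, where the
`y_j` are the basis of `V*` dual to the basis `x_j^m` of `V`. -/
def IsCovariant (r p m : ℕ) {n : ℕ} (F : Fin n → Poly n) : Prop :=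
  ∀ w ∈ G r p n, ∀ σ a, IsEntries r p a → ActsMonomially w σ a →
    ∀ j, polyAct n w (F j) = a j ^ m • F (σ j)

/-- The rows of this matrix are the coefficients of the basic invariant one-forms. -/
def covMatrix (r p m k : ℕ) : Matrix (Fin (k + 1)) (Fin (k + 1)) (Poly (k + 1)) :=
  Matrix.of fun i j => Fin.cases
    (X j ^ (m % (r / p)) * ∏ l ∈ Finset.univ.erase j, X l ^ (r - m % r + m % (r / p)))
    (fun i : Fin k => X j ^ (m % r + i * r)) i

/-- The degrees of the rows of `covMatrix`. -/
def covDegree (r p m k : ℕ) : Fin (k + 1) → ℕ :=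
  Fin.cases (k * (r - m % r) + (k + 1) * (m % (r / p))) fun i : Fin k => m % r + i * r

section

variable {r p m k : ℕ}

@[simp] lemma covMatrix_zero (j) : covMatrix r p m k 0 j =
    X j ^ (m % (r / p)) * ∏ l ∈ Finset.univ.erase j, X l ^ (r - m % r + m % (r / p)) := rfl

@[simp] lemma covMatrix_succ (i : Fin k) (j) :
    covMatrix r p m k i.succ j = X j ^ (m % r + i * r) := rfl

lemma covMatrix_isHomogeneous (i j) : (covMatrix r p m k i j).IsHomogeneous (covDegree r p m k i) := by
  refine Fin.cases ?_ (fun i => ?_) i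
  · have h := ((isHomogeneous_X ℂ j).pow (m % (r / p))).mul (IsHomogeneous.prod
      (Finset.univ.erase j) (fun l => (X l : Poly (k + 1)) ^ (r - m % r + m % (r / p))) _
      (fun l _ => (isHomogeneous_X ℂ l).pow _))
    rw [covMatrix_zero]
    convert h using 1
    simp [covDegree]
    ring
  · have h := (isHomogeneous_X ℂ j).pow (m % r + i * r)
    rw [one_mul] at h
    exact h

lemma explicitExponents_eq (hr : 0 < r) : explicitExponents r p (k + 1) m =
    Finset.univ.val.map (covDegree r p m k) := by
  have h : Finset.univ.val.map (covDegree r p m k) = (k * (r - m % r) + (k + 1) * (m % (r / p))) ::ₘ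
      (Multiset.range k).map fun i => m % r + i * r := by
    rw [Fin.univ_succ, Finset.cons_val, Multiset.map_cons, Finset.map_val, Multiset.map_map]
    congr 1
    rw [← Finset.range_val, ← Nat.Iio_eq_range, ← Fin.map_valEmbedding_univ, Finset.map_val,
      Multiset.map_map]
    rfl
  rw [h, explicitExponents]
  split_ifs with hp
  · rw [Multiset.range_succ, Multiset.map_cons, hp, Nat.div_one]
    congr 1
    -- For p = 1 both remainders equal m̄, and k (r - m̄) + (k + 1) m̄ = m̄ + k r.
    have := Nat.mod_lt m hr
    obtain ⟨c, hc⟩ := Nat.exists_eq_add_of_lt this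
    have : r - m % r = c + 1 := by omega
    rw [this]
    nth_rewrite 2 [hc]
    ring
  · rfl

/-- Both r and m̄ - m' are multiples of r/p. This makes the power of x_1⋯x_n hidden in row 0 of
`covMatrix` invariant. -/
lemma mod_add_sub_mod_dvd (hr : 0 < r) (hpr : p ∣ r) : r / p ∣ r - m % r + m % (r / p) := by
  have h1 : m % (r / p) = m % r % (r / p) := (Nat.mod_mod_of_dvd m (Nat.div_dvd_of_dvd hpr)).symm
  have h2 := Nat.mod_le (m % r) (r / p)
  have h3 := Nat.mod_lt m hr
  have h4 : r - m % r + m % (r / p) = r - (m % r - m % r % (r / p)) := by omega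
  rw [h4]
  exact Nat.dvd_sub (Nat.div_dvd_of_dvd hpr) (Nat.dvd_sub_mod _)

lemma covMatrix_isCovariant (hr : 0 < r) (hpr : p ∣ r) (i) :
    IsCovariant r p m (covMatrix r p m k i) := by
  intro w hw σ a ha hact j
  have hpow : ∀ b c d : ℕ, b + r * c = d → ∀ j, a j ^ d = a j ^ b := by
    rintro b c d rfl j
    rw [pow_add, pow_mul, ha.1, one_pow, mul_one]
  refine Fin.cases ?_ (fun i => ?_) i
  · rw [covMatrix_zero, covMatrix_zero, map_mul, map_prod]
    simp only [map_pow, hact _, smul_pow]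
    rw [Finset.prod_smul, smul_mul_smul_comm]
    congr 1
    · have h0 : a j ≠ 0 := fun h => by
        have := ha.1 j
        simp [h, hr.ne'] at this
      have h1 : ∏ l, a l ^ (r - m % r + m % (r / p)) = 1 := by
        obtain ⟨c, hc⟩ := mod_add_sub_mod_dvd (m := m) hr hpr
        rw [Finset.prod_pow, hc, pow_mul, ha.2, one_pow]
      rw [← Finset.mul_prod_erase _ _ (Finset.mem_univ j)] at h1
      -- With s = r - m̄ + m', the factor a_j^s completes the product over l ≠ j to the full
      -- product, which is 1. What remains is a_j^(s + m) = a_j^m', true because s + m = m' + r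
      -- (⌊m/r⌋ + 1).
      apply mul_left_cancel₀ (pow_ne_zero (r - m % r + m % (r / p)) h0)
      rw [mul_left_comm, h1, ← pow_add, mul_one]
      refine (hpow _ (m / r + 1) _ ?_ j).symm
      have := Nat.mod_lt m hr
      have := Nat.div_add_mod m r
      rw [mul_add, mul_one]
      omega
    · congr 1
      exact Finset.prod_equiv σ (by simp) (fun _ _ => rfl)
  · rw [covMatrix_succ, covMatrix_succ, map_pow, hact, smul_pow]
    congr 1
    trans a j ^ (m % r)
    · exact hpow _ i _ (by ring) j
    · exact (hpow _ (m / r) _ (Nat.mod_add_div m r) j).symm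

lemma det_covMatrix (hr : 0 < r) : (covMatrix r p m k).det =
    (∏ i, X i) ^ (m % (r / p)) * ∏ i : Fin (k + 1), ∏ j ∈ Finset.Ioi i, (X j ^ r - X i ^ r) := by
  have hlt := Nat.mod_lt m hr
  have h0 : (∏ j : Fin (k + 1), (X j : Poly (k + 1)) ^ (r - m % r)) ≠ 0 :=
    Finset.prod_ne_zero_iff.2 fun j _ => pow_ne_zero _ (X_ne_zero j)
  apply mul_left_cancel₀ h0
  rw [← Matrix.det_mul_row, ← Matrix.det_vandermonde, ← Matrix.det_transpose (Matrix.vandermonde _),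
    ← mul_assoc, Finset.prod_pow, ← pow_add]
  -- After the column scaling, row 0 is constant and row i + 1 consists of the powers (x_j^r)^(i +
  -- 1).
  have h : (Matrix.of fun i j => X j ^ (r - m % r) * covMatrix r p m k i j) =
      Matrix.of fun i j => (Fin.cases ((∏ i, X i) ^ (r - m % r + m % (r / p))) (fun _ => 1) i :
        Poly (k + 1)) * (Matrix.vandermonde fun j => X j ^ r).transpose i j := by
    ext1 i j
    refine Fin.cases ?_ (fun i => ?_) i
    · simp only [Matrix.of_apply, covMatrix_zero, Fin.cases_zero, Matrix.transpose_apply,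
        Matrix.vandermonde_apply, Fin.val_zero, pow_zero, mul_one]
      rw [← mul_assoc, ← pow_add, Finset.mul_prod_erase _ (fun l =>
        (X l : Poly (k + 1)) ^ (r - m % r + m % (r / p))) (Finset.mem_univ j), Finset.prod_pow]
    · simp only [Matrix.of_apply, covMatrix_succ, Fin.cases_succ, Matrix.transpose_apply,
        Matrix.vandermonde_apply, Fin.val_succ, one_mul, ← pow_add, ← pow_mul]
      congr 1
      rw [mul_add, mul_one, mul_comm r]
      omega
  rw [h, Matrix.det_mul_column, Fin.prod_univ_succ]
  simp

lemma det_covMatrix_ne_zero (hr : 0 < r) : (covMatrix r p m k).det ≠ 0 := by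
  rw [det_covMatrix hr]
  refine mul_ne_zero (pow_ne_zero _ (Finset.prod_ne_zero_iff.2 fun j _ => X_ne_zero j)) ?_
  refine Finset.prod_ne_zero_iff.2 fun i _ => Finset.prod_ne_zero_iff.2 fun j hj h => ?_
  have := congrArg (MvPolynomial.eval (Pi.single j (1 : ℂ))) h
  simp [(Finset.mem_Ioi.1 hj).ne, hr.ne'] at this

/-- The action of w multiplies column j by a_j^m and permutes the columns by σ. -/
lemma isSemiinvariant_det {n : ℕ} {M : Matrix (Fin n) (Fin n) (Poly n)}
    (hM : ∀ i, IsCovariant r p m (M i)) : IsSemiinvariant r p m M.det := by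
  intro w hw σ a ha hact
  have h : (polyAct n w).mapMatrix M =
      Matrix.of fun i j => C (a j ^ m) * (M.submatrix id σ) i j := by
    ext1 i j
    simp [hM i w hw σ a ha hact j, smul_eq_C_mul]
  rw [AlgHom.map_det, h, Matrix.det_mul_row, Matrix.det_permute', smul_eq_C_mul, C_mul, ← map_prod,
    Finset.prod_pow]
  rcases Int.units_eq_one_or (Equiv.Perm.sign σ) with h | h <;> simp [h]

lemma IsSemiinvariant.mem_invariantRing_of_mul {n : ℕ} (hr : 0 < r) {d u : Poly n} (hd : d ≠ 0)
    (h : IsSemiinvariant r p m d) (hu : IsSemiinvariant r p m (d * u)) :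
    u ∈ invariantRing (G r p n) := by
  rintro ⟨w, hw⟩
  obtain ⟨σ, a, ha, hact⟩ := exists_actsMonomially hw
  have h1 := hu w hw σ a ha hact
  have h2 := h w hw σ a ha hact
  rw [map_mul, h2, smul_eq_C_mul, smul_eq_C_mul, mul_assoc] at h1
  have h0 : ((Equiv.Perm.sign σ : ℤ) * (∏ i, a i) ^ m : ℂ) ≠ 0 := by
    refine mul_ne_zero (Int.cast_ne_zero.2 (Units.ne_zero _))
      (pow_ne_zero _ (Finset.prod_ne_zero_iff.2 fun i _ hi => ?_))
    have := ha.1 i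
    simp [hi, hr.ne'] at this
  exact mul_left_cancel₀ hd (mul_left_cancel₀ (C_ne_zero.2 h0) h1)

/-- A semi-invariant is the product of `det (covMatrix r p m k)` and an invariant. -/
lemma IsSemiinvariant.exists_eq_mul (hr : 0 < r) (hpr : p ∣ r) {h : Poly (k + 1)}
    (hh : IsSemiinvariant r p m h) :
    ∃ u ∈ invariantRing (G r p (k + 1)), h = (covMatrix r p m k).det * u := by
  have hdvd := hh.prod_dvd hr hpr
  rw [← det_covMatrix hr] at hdvd
  obtain ⟨u, rfl⟩ := hdvd
  exact ⟨u, IsSemiinvariant.mem_invariantRing_of_mul hr (det_covMatrix_ne_zero hr)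
    (isSemiinvariant_det (covMatrix_isCovariant hr hpr)) hh, rfl⟩

/-- The covariants are the combinations of the rows of `covMatrix` with invariant coefficients. -/
lemma IsCovariant.exists_eq_sum (hr : 0 < r) (hpr : p ∣ r) {F : Fin (k + 1) → Poly (k + 1)}
    (hF : IsCovariant r p m F) :
    ∃ c : Fin (k + 1) → Poly (k + 1), (∀ i, c i ∈ invariantRing (G r p (k + 1))) ∧
      ∀ j, F j = ∑ i, c i * covMatrix r p m k i j := by
  set M := covMatrix r p m k
  have h1 : ∀ i, ∃ u ∈ invariantRing (G r p (k + 1)), (M.updateRow i F).det = M.det * u := by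
    -- Cramer's rule: the coefficient of row i is the determinant with that row replaced by F,
    -- divided by det M. The numerator is again a determinant of covariants, so the quotient is an
    -- invariant polynomial.
    refine fun i => IsSemiinvariant.exists_eq_mul hr hpr (isSemiinvariant_det fun l => ?_)
    by_cases hl : l = i
    · subst hl
      rw [Matrix.updateRow_self]
      exact hF
    · rw [Matrix.updateRow_ne hl]
      exact covMatrix_isCovariant hr hpr l
  choose c hc hdet using h1
  refine ⟨c, hc, fun j => mul_left_cancel₀ (det_covMatrix_ne_zero (p := p) (m := m) (k := k) hr) ?_⟩
  have h2 := congrFun (Matrix.mulVec_cramer M.transpose F) j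
  rw [Matrix.det_transpose] at h2
  change _ = M.det * F j at h2
  rw [← h2, Finset.mul_sum, Matrix.mulVec, dotProduct]
  refine Finset.sum_congr rfl fun i _ => ?_
  rw [Matrix.cramer_transpose_apply, hdet, Matrix.transpose_apply]
  ring

lemma covMatrix_linearIndependent (hr : 0 < r) {c : Fin (k + 1) → Poly (k + 1)}
    (hc : ∀ j, ∑ i, c i * covMatrix r p m k i j = 0) : c = 0 :=
  Matrix.eq_zero_of_vecMul_eq_zero (det_covMatrix_ne_zero hr) (funext hc)

end

/-! ### The module V and its irreducibility -/

lemma linearIndependent_X_pow (n : ℕ) {m : ℕ} (hm : m ≠ 0) :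
    LinearIndependent ℂ fun i : Fin n => (X i : Poly n) ^ m := by
  have h := (basisMonomials (Fin n) ℂ).linearIndependent.comp (fun i => Finsupp.single i m)
    (Finsupp.single_left_injective hm)
  have h' : (fun i : Fin n => (X i : Poly n) ^ m) =
      ⇑(basisMonomials (Fin n) ℂ) ∘ fun i => Finsupp.single i m := by
    ext1 i
    simp [X_pow_eq_monomial]
  rw [h']
  exact h

/-- The basis `x_1^m, …, x_n^m` of `powerRep r p n m`. -/
def powerBasis (r p n : ℕ) {m : ℕ} (hm : m ≠ 0) :
    Module.Basis (Fin n) ℂ (powerRep r p n m).toSubmodule :=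
  Module.Basis.span (linearIndependent_X_pow n hm)

section

variable {r p n m : ℕ} (hm : m ≠ 0)

@[simp] lemma coe_powerBasis (i : Fin n) :
    (powerBasis r p n hm i : Poly n) = X i ^ m := by
  exact Module.Basis.coe_span_apply (linearIndependent_X_pow n hm) i

lemma powerRep_apply_powerBasis (w : G r p n) {σ : Equiv.Perm (Fin n)} {a : Fin n → ℂ}
    (hact : ActsMonomially w σ a) (i : Fin n) :
    (powerRep r p n m).toRepresentation w (powerBasis r p n hm i) =
      a i ^ m • powerBasis r p n hm (σ i) := by
  apply Subtype.ext
  rw [Submodule.coe_smul, coe_powerBasis]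
  change polyAct n w (powerBasis r p n hm i : Poly n) = _
  rw [coe_powerBasis, map_pow, hact, smul_pow]

lemma repr_powerRep_apply (w : G r p n) {a : Fin n → ℂ} (hact : ActsMonomially w 1 a)
    (v : (powerRep r p n m).toSubmodule) (i : Fin n) :
    (powerBasis r p n hm).repr ((powerRep r p n m).toRepresentation w v) i =
      a i ^ m * (powerBasis r p n hm).repr v i := by
  conv_lhs => rw [← (powerBasis r p n hm).sum_repr v, map_sum, map_sum, Finsupp.finsetSum_apply]
  rw [Finset.sum_eq_single i]
  · rw [map_smul, powerRep_apply_powerBasis hm w hact]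
    simp [mul_comm]
  · intro j _ hj
    rw [map_smul, powerRep_apply_powerBasis hm w hact]
    simp [hj]
  · simp

/-- Separates the characters of the diagonal group on x_i^m and x_l^m. If r ∤ 2m, entries ζ, ζ⁻¹ at
i, l work, their m-th powers having ratio ζ^(2m). If r ∣ 2m and there is a third index c, entries ζ,
ζ⁻¹ at i, c work because r ∤ m. Otherwise n = 2 and p is odd, and ζ^p at i alone works: r ∣ pm and r
∣ 2m would give r ∣ m. -/
lemma exists_isEntries_pow_ne (hr : 0 < r) (hpr : p ∣ r) (hm : ¬ r ∣ m)
    (h2 : ¬ (n = 2 ∧ Even p ∧ r ∣ 2 * m)) {i l : Fin n} (hil : i ≠ l) :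
    ∃ a : Fin n → ℂ, IsEntries r p a ∧ a i ^ m ≠ a l ^ m := by
  obtain ⟨ζ, hζ⟩ : ∃ ζ : ℂ, IsPrimitiveRoot ζ r := ⟨_, Complex.isPrimitiveRoot_exp r hr.ne'⟩
  have h0 : ζ ≠ 0 := hζ.ne_zero hr.ne'
  have key : ∀ c, c ≠ i → ∃ a : Fin n → ℂ, IsEntries r p a ∧ a i = ζ ∧ a c = ζ⁻¹ ∧
      ∀ l, l ≠ i → l ≠ c → a l = 1 := by
    intro c hc
    refine ⟨fun j => if j = i then ζ else if j = c then ζ⁻¹ else 1, ⟨fun j => ?_, ?_⟩,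
      if_pos rfl, by simp [hc], fun l h h' => by simp [h, h']⟩
    · dsimp only
      split_ifs <;> simp [hζ.pow_eq_one]
    · rw [← Finset.prod_subset (Finset.subset_univ {i, c})]
      · rw [Finset.prod_pair hc.symm]
        simp [hc, h0]
      · intro l _ hl
        simp only [Finset.mem_insert, Finset.mem_singleton, not_or] at hl
        simp [hl]
  by_cases hrm : r ∣ 2 * m
  · by_cases hc : ∃ c, c ≠ i ∧ c ≠ l
    · obtain ⟨c, hci, hcl⟩ := hc
      obtain ⟨a, ha, hi, -, hl⟩ := key c hci
      refine ⟨a, ha, ?_⟩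
      rw [hi, hl l hil.symm hcl.symm, one_pow]
      exact fun h => hm (hζ.dvd_of_pow_eq_one _ h)
    · have hn : n = 2 := by
        have h1 : (Finset.univ : Finset (Fin n)) = {i, l} := by
          ext c
          simp only [Finset.mem_univ, Finset.mem_insert, Finset.mem_singleton, true_iff]
          by_contra! h
          exact hc ⟨c, h⟩
        have := congrArg Finset.card h1
        rwa [Finset.card_pair hil, Finset.card_univ, Fintype.card_fin] at this
      have hp : Odd p := Nat.not_even_iff_odd.1 fun hp => h2 ⟨hn, hp, hrm⟩
      refine ⟨Pi.mulSingle i (ζ ^ p), ⟨fun j => ?_, ?_⟩, ?_⟩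
      · rw [Pi.mulSingle_apply]
        split_ifs
        · rw [pow_right_comm, hζ.pow_eq_one, one_pow]
        · simp
      · rw [Fintype.prod_pi_mulSingle', ← pow_mul, Nat.mul_div_cancel' hpr, hζ.pow_eq_one]
      · rw [Pi.mulSingle_eq_same, Pi.mulSingle_eq_of_ne hil.symm, one_pow, ← pow_mul]
        intro h
        have h3 := Nat.dvd_gcd (hζ.dvd_of_pow_eq_one _ h) hrm
        rw [Nat.gcd_mul_right, Nat.Coprime.gcd_eq_one hp.coprime_two_right, one_mul] at h3
        exact hm h3
  · obtain ⟨a, ha, hi, hl, -⟩ := key l hil.symm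
    refine ⟨a, ha, ?_⟩
    rw [hi, hl, inv_pow]
    intro h
    refine hrm (hζ.dvd_of_pow_eq_one _ ?_)
    rw [mul_comm, pow_mul, sq]
    nth_rewrite 1 [h]
    exact inv_mul_cancel₀ (pow_ne_zero _ h0)

theorem powerRep_isIrreducible (hr : 0 < r) (hpr : p ∣ r) (hn : 1 ≤ n) (hm : ¬ r ∣ m)
    (h2 : ¬ (n = 2 ∧ Even p ∧ r ∣ 2 * m)) :
    (powerRep r p n m).toRepresentation.IsIrreducible := by
  have hm0 : m ≠ 0 := fun h => hm (h ▸ dvd_zero r)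
  set ρ := (powerRep r p n m).toRepresentation
  set b := powerBasis r p n hm0
  have hbot : ∀ v, v ∈ (⊥ : Subrepresentation ρ) ↔ v = 0 := fun v => Submodule.mem_bot ℂ
  refine { exists_pair_ne := ⟨⊥, ⊤, fun h => ?_⟩, eq_bot_or_eq_top := fun U => ?_ }
  · have h1 : b ⟨0, hn⟩ ∈ (⊤ : Subrepresentation ρ) := Submodule.mem_top
    rw [← h, hbot] at h1
    exact b.ne_zero _ h1
  by_cases hU : ∀ u ∈ U, u = 0
  · left
    apply SetLike.ext
    intro v
    rw [hbot]
    exact ⟨hU v, fun h => h ▸ U.toSubmodule.zero_mem⟩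
  right
  push Not at hU
  obtain ⟨u, huU, hu0⟩ := hU
  obtain ⟨i, hi⟩ : ∃ i, b.repr u i ≠ 0 := by
    by_contra! h
    exact hu0 (b.repr.map_eq_zero_iff.1 (Finsupp.ext h))
  -- Coordinates other than i are removed one at a time: w - a_l^m, for a diagonal w separating i
  -- from l, kills coordinate l and keeps coordinate i non-zero.
  have key : ∀ s : Finset (Fin n), i ∉ s →
      ∃ u ∈ U, b.repr u i ≠ 0 ∧ ∀ l ∈ s, b.repr u l = 0 := by
    intro s
    induction s using Finset.induction_on with
    | empty => exact fun _ => ⟨u, huU, hi, by simp⟩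
    | insert l s hls ih =>
      intro his
      rw [Finset.mem_insert, not_or] at his
      obtain ⟨v, hvU, hvi, hvs⟩ := ih his.2
      obtain ⟨a, ha, hne⟩ := exists_isEntries_pow_ne hr hpr hm h2 his.1
      obtain ⟨w, hw, hact⟩ := exists_mem_actsMonomially hr.ne' 1 ha
      have hrepr : ∀ j, b.repr (ρ ⟨w, hw⟩ v - a l ^ m • v) j =
          (a j ^ m - a l ^ m) * b.repr v j := by
        intro j
        rw [map_sub, Finsupp.sub_apply, repr_powerRep_apply hm0 ⟨w, hw⟩ hact]
        simp [b, sub_mul]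
      refine ⟨ρ ⟨w, hw⟩ v - a l ^ m • v, U.toSubmodule.sub_mem (U.apply_mem_toSubmodule _ hvU)
        (U.toSubmodule.smul_mem _ hvU), ?_, fun j hj => ?_⟩
      · rw [hrepr]
        exact mul_ne_zero (sub_ne_zero.2 hne) hvi
      · rw [hrepr]
        rcases Finset.mem_insert.1 hj with rfl | hj
        · simp
        · simp [hvs j hj]
  obtain ⟨v, hvU, hvi, hv⟩ := key (Finset.univ.erase i) (by simp)
  have hv' : v = b.repr v i • b i := by
    conv_lhs => rw [← b.sum_repr v]
    exact Finset.sum_eq_single i (fun j _ hj => by simp [hv j (by simpa using hj)]) (by simp)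
  have hbi : b i ∈ U := by
    rw [hv'] at hvU
    exact (U.toSubmodule.smul_mem_iff hvi).1 hvU
  have hb : ∀ j, b j ∈ U := by
    intro j
    obtain ⟨w, hw, hact⟩ := exists_mem_actsMonomially (r := r) (p := p) hr.ne' (Equiv.swap i j)
      (a := fun _ => 1) ⟨by simp, by simp⟩
    have := U.apply_mem_toSubmodule ⟨w, hw⟩ hbi
    rw [powerRep_apply_powerBasis hm0 ⟨w, hw⟩ hact] at this
    rw [one_pow, one_smul, Equiv.swap_apply_left] at this
    exact this
  apply SetLike.ext
  intro x
  refine ⟨fun _ => Submodule.mem_top, fun _ => ?_⟩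
  rw [← b.sum_repr x]
  exact U.toSubmodule.sum_mem fun j _ => U.toSubmodule.smul_mem _ (hb j)

end

end ReflRep
end

noncomputable section

namespace ReflRep

/-! ### Products of anticommuting elements -/

section Wedge

variable {ι A : Type*} [Ring A]

/-- The elements `x i` anticommute and have square zero. -/
structure IsAnticomm (x : ι → A) : Prop where
  mul_self : ∀ i, x i * x i = 0
  mul_comm : ∀ i j, x i * x j = -(x j * x i)

/-- The product of the `x i`, `i ∈ I`, in some order. -/
def wedge (x : ι → A) (I : Finset ι) : A := (I.toList.map x).prod

variable {x : ι → A}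

lemma map_wedge {B F : Type*} [Ring B] [FunLike F A B] [MonoidHomClass F A B] (φ : F)
    (I : Finset ι) : φ (wedge x I) = wedge (fun i => φ (x i)) I := by
  simp [wedge, map_list_prod, Function.comp_def]

/-- Each exchange of neighbours changes the sign. Only the product up to sign is ever used, so the
signature is not tracked. -/
lemma IsAnticomm.prod_perm (hx : IsAnticomm x) {l₁ l₂ : List ι} (h : l₁.Perm l₂) :
    (l₁.map x).prod = (l₂.map x).prod ∨ (l₁.map x).prod = -(l₂.map x).prod := by
  induction h with
  | nil => simp
  | cons a _ ih => rcases ih with ih | ih <;> simp [ih]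
  | swap a b l =>
    right
    simp only [List.map_cons, List.prod_cons, ← mul_assoc]
    rw [hx.mul_comm b a, neg_mul]
  | trans _ _ h₁ h₂ => rcases h₁ with h₁ | h₁ <;> rcases h₂ with h₂ | h₂ <;> simp [h₁, h₂]

lemma IsAnticomm.prod_eq_zero (hx : IsAnticomm x) {l : List ι} (h : ¬ l.Nodup) :
    (l.map x).prod = 0 := by
  classical
  obtain ⟨a, ha⟩ := List.exists_duplicate_iff_not_nodup.2 h
  obtain ⟨l', hl'⟩ := (List.duplicate_iff_sublist.1 ha).exists_perm_append
  have h0 : (([a, a] ++ l').map x).prod = 0 := by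
    simp [← mul_assoc, hx.mul_self]
  rcases hx.prod_perm hl' with h | h <;> rw [h, h0]
  rw [neg_zero]

lemma IsAnticomm.prod_eq_wedge [DecidableEq ι] (hx : IsAnticomm x) {l : List ι} (h : l.Nodup) :
    (l.map x).prod = wedge x l.toFinset ∨ (l.map x).prod = -wedge x l.toFinset :=
  hx.prod_perm (List.toFinset_toList h).symm

lemma IsAnticomm.wedge_mul_wedge [DecidableEq ι] (hx : IsAnticomm x) {I J : Finset ι}
    (h : Disjoint I J) :
    wedge x I * wedge x J = wedge x (I ∪ J) ∨ wedge x I * wedge x J = -wedge x (I ∪ J) := by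
  have hl : (I.toList ++ J.toList).Nodup := by
    refine List.Nodup.append I.nodup_toList J.nodup_toList fun a ha hb => ?_
    exact Finset.disjoint_left.1 h (Finset.mem_toList.1 ha) (Finset.mem_toList.1 hb)
  have := hx.prod_eq_wedge hl
  simpa [wedge] using this

lemma IsAnticomm.wedge_mul_wedge_eq_zero (hx : IsAnticomm x) {I J : Finset ι}
    (h : ¬ Disjoint I J) : wedge x I * wedge x J = 0 := by
  rw [wedge, wedge, ← List.prod_append, ← List.map_append]
  refine hx.prod_eq_zero fun hl => h (Finset.disjoint_left.2 fun a ha hb => ?_)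
  exact List.disjoint_of_nodup_append hl (Finset.mem_toList.2 ha) (Finset.mem_toList.2 hb)

lemma IsAnticomm.mem_span_wedge {R : Type*} [CommRing R] [Algebra R A] (hx : IsAnticomm x)
    {y : A} (hy : y ∈ Algebra.adjoin R (Set.range x)) :
    y ∈ Submodule.span R (Set.range (wedge x)) := by
  classical
  rw [← Subalgebra.mem_toSubmodule, Algebra.adjoin_eq_span] at hy
  refine Submodule.span_le.2 (fun z hz => ?_) hy
  obtain ⟨l, hl, rfl⟩ := Submonoid.exists_list_of_mem_closure hz
  obtain ⟨l, rfl⟩ : l ∈ Set.range (List.map x) := by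
    rw [Set.range_list_map]
    exact hl
  by_cases h : l.Nodup
  · rcases hx.prod_eq_wedge h with h | h <;> rw [SetLike.mem_coe, h]
    · exact Submodule.subset_span ⟨_, rfl⟩
    · exact Submodule.neg_mem _ (Submodule.subset_span ⟨_, rfl⟩)
  · rw [SetLike.mem_coe, hx.prod_eq_zero h]
    exact Submodule.zero_mem _

lemma IsAnticomm.sum_mul_self {R : Type*} [CommRing R] [Algebra R A] (hx : IsAnticomm x)
    (c : ι → R) (s : Finset ι) : (∑ i ∈ s, c i • x i) * (∑ i ∈ s, c i • x i) = 0 := by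
  classical
  induction s using Finset.induction_on with
  | empty => simp
  | insert a s ha ih =>
    have h : c a • x a * ∑ i ∈ s, c i • x i = -((∑ i ∈ s, c i • x i) * c a • x a) := by
      rw [Finset.mul_sum, Finset.sum_mul, ← Finset.sum_neg_distrib]
      refine Finset.sum_congr rfl fun i _ => ?_
      rw [smul_mul_smul_comm, smul_mul_smul_comm, hx.mul_comm, smul_neg, _root_.mul_comm]
    rw [Finset.sum_insert ha, mul_add, add_mul, add_mul, ih, h, smul_mul_smul_comm, hx.mul_self]
    simp

section Top

variable {S : Type*} [CommRing S] [Algebra S A] [Fintype ι] [DecidableEq ι]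
  {top : A →ₗ[S] S}

/-- Up to sign, the wedges of complements are dual to the wedges under (y, z) ↦ `top (y * z)`. If I
meets Jᶜ, the product has a repeated factor; if they are disjoint and I ≠ J, the union is not
everything and `top` kills it. -/
lemma IsAnticomm.top_wedge_mul_wedge_compl (hx : IsAnticomm x)
    (htop : ∀ I ≠ Finset.univ, top (wedge x I) = 0) (J : Finset ι) :
    ∃ ε : S, (ε = 1 ∨ ε = -1) ∧ ∀ I, top (wedge x I * wedge x Jᶜ) =
      if I = J then ε * top (wedge x Finset.univ) else 0 := by
  have hne : ∀ I, I ≠ J → top (wedge x I * wedge x Jᶜ) = 0 := by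
    intro I hIJ
    by_cases hd : Disjoint I Jᶜ
    · have hu : I ∪ Jᶜ ≠ Finset.univ := fun hu => hIJ (by
        have := (IsCompl.of_eq (disjoint_iff.1 hd) hu).eq_compl
        rwa [compl_compl] at this)
      rcases hx.wedge_mul_wedge hd with h | h <;> simp [h, htop _ hu]
    · rw [hx.wedge_mul_wedge_eq_zero hd, map_zero]
  rcases hx.wedge_mul_wedge (disjoint_compl_right (a := J)) with h | h
  · refine ⟨1, Or.inl rfl, fun I => ?_⟩
    split_ifs with hI
    · rw [hI, h, Finset.union_compl, one_mul]
    · exact hne I hI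
  · refine ⟨-1, Or.inr rfl, fun I => ?_⟩
    split_ifs with hI
    · rw [hI, h, Finset.union_compl, map_neg, neg_one_mul]
    · exact hne I hI

variable [IsDomain S]

lemma IsAnticomm.wedge_linearIndependent (hx : IsAnticomm x)
    (htop : ∀ I ≠ Finset.univ, top (wedge x I) = 0) (h0 : top (wedge x Finset.univ) ≠ 0)
    {c : Finset ι → S} (hc : ∑ I, c I • wedge x I = 0) : c = 0 := by
  ext J
  obtain ⟨ε, hε, h⟩ := hx.top_wedge_mul_wedge_compl htop J
  have h1 := congrArg (fun y => top (y * wedge x Jᶜ)) hc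
  simp only [Finset.sum_mul, smul_mul_assoc, map_sum, map_smul, h, smul_eq_mul, zero_mul, map_zero,
    mul_ite, mul_zero, Finset.sum_ite_eq', Finset.mem_univ, if_true] at h1
  rcases hε with rfl | rfl <;> simpa [h0] using h1

/-- Solomon's argument. The element y is a combination of wedges with denominator s. Pairing with
the wedge of Jᶜ isolates the coefficient g_J / s, and `hR` says that this is, up to sign, an element
of R. -/
lemma IsAnticomm.exists_eq_sum_wedge [Module.IsTorsionFree S A] (hx : IsAnticomm x)
    (htop : ∀ I ≠ Finset.univ, top (wedge x I) = 0) (h0 : top (wedge x Finset.univ) ≠ 0)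
    {R : Subring S} {y : A} {s : S} (hs : s ≠ 0) (hy : s • y ∈ Submodule.span S (Set.range (wedge x)))
    (hR : ∀ J, ∃ u ∈ R, top (y * wedge x J) = top (wedge x Finset.univ) * u) :
    ∃ c : Finset ι → R, y = ∑ I, (c I : S) • wedge x I := by
  obtain ⟨g, hg⟩ := (Submodule.mem_span_range_iff_exists_fun S).1 hy
  have key : ∀ J, ∃ u : R, g J = s * u := by
    intro J
    obtain ⟨ε, hε, h⟩ := hx.top_wedge_mul_wedge_compl htop J
    obtain ⟨u, hu, huJ⟩ := hR Jᶜ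
    have h1 := congrArg (fun y => top (y * wedge x Jᶜ)) hg
    simp only [Finset.sum_mul, smul_mul_assoc, map_sum, map_smul, h, smul_eq_mul,
      mul_ite, mul_zero, Finset.sum_ite_eq', Finset.mem_univ, if_true, huJ] at h1
    rcases hε with rfl | rfl
    · refine ⟨⟨u, hu⟩, mul_left_cancel₀ h0 ?_⟩
      linear_combination h1
    · refine ⟨⟨-u, neg_mem hu⟩, mul_left_cancel₀ h0 ?_⟩
      linear_combination -h1
  choose c hc using key
  refine ⟨c, smul_right_injective A hs ?_⟩
  simp only [Finset.smul_sum, smul_smul, ← hc, hg]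

end Top

end Wedge

/-! ### A criterion for free exterior algebras -/

section ExteriorAlgebra

variable {R : Type*} [CommRing R] {n : ℕ}

lemma isAnticomm_ι : IsAnticomm fun i : Fin n => ExteriorAlgebra.ι R (Pi.single i (1 : R)) where
  mul_self _ := ExteriorAlgebra.ι_sq_zero _
  mul_comm _ _ := eq_neg_of_add_eq_zero_left (ExteriorAlgebra.ι_add_mul_swap _ _)

lemma exists_eq_sum_wedge_ι (z : ExteriorAlgebra R (Fin n → R)) :
    ∃ c : Finset (Fin n) → R,
      z = ∑ I, c I • wedge (fun i => ExteriorAlgebra.ι R (Pi.single i (1 : R))) I := by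
  have h : z ∈ Algebra.adjoin R
      (Set.range fun i : Fin n => ExteriorAlgebra.ι R (Pi.single i (1 : R))) := by
    induction z using ExteriorAlgebra.induction with
    | algebraMap c => exact Subalgebra.algebraMap_mem _ c
    | ι v =>
      rw [pi_eq_sum_univ' v, map_sum]
      refine Subalgebra.sum_mem _ fun i _ => ?_
      rw [map_smul]
      refine Subalgebra.smul_mem _ (Algebra.subset_adjoin (Set.mem_range.2 ⟨i, ?_⟩)) _
      congr 1
    | mul a b ha hb => exact Subalgebra.mul_mem _ ha hb
    | add a b ha hb => exact Subalgebra.add_mem _ ha hb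
  obtain ⟨c, hc⟩ := (Submodule.mem_span_range_iff_exists_fun R).1 (isAnticomm_ι.mem_span_wedge h)
  exact ⟨c, hc.symm⟩

/-- Criterion for an algebra to be a free exterior algebra. -/
lemma isFreeExterior_of_wedge {A : Type*} [Ring A] [Algebra R A] {x : Fin n → A} {M : Set A}
    (hx : IsAnticomm x) (hM : ∀ v : Fin n → R, ∑ i, v i • x i ∈ M)
    (hli : ∀ c : Finset (Fin n) → R, ∑ I, c I • wedge x I = 0 → c = 0)
    (hspan : ∀ y, ∃ c : Finset (Fin n) → R, y = ∑ I, c I • wedge x I) :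
    IsFreeExterior R A n M := by
  let f : (Fin n → R) →ₗ[R] A := Fintype.linearCombination R x
  have hf : ∀ v, f v * f v = 0 := fun v => by
    rw [Fintype.linearCombination_apply]
    exact hx.sum_mul_self v _
  let φ := ExteriorAlgebra.lift R ⟨f, hf⟩
  have hφ : ∀ c : Finset (Fin n) → R,
      φ (∑ I, c I • wedge (fun i => ExteriorAlgebra.ι R (Pi.single i (1 : R))) I) =
        ∑ I, c I • wedge x I := by
    intro c
    rw [map_sum]
    refine Finset.sum_congr rfl fun I _ => ?_
    rw [map_smul, map_wedge]
    congr 2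
    ext i
    simp [φ, f, Fintype.linearCombination_apply_single]
  have hb : Function.Bijective φ := by
    refine ⟨(injective_iff_map_eq_zero φ).2 fun z hz => ?_, fun y => ?_⟩
    · obtain ⟨c, rfl⟩ := exists_eq_sum_wedge_ι z
      rw [hφ] at hz
      simp [hli c hz]
    · obtain ⟨c, rfl⟩ := hspan y
      exact ⟨_, hφ c⟩
  refine ⟨AlgEquiv.ofBijective φ hb, fun v => ?_⟩
  rw [AlgEquiv.ofBijective_apply, ExteriorAlgebra.lift_ι_apply]
  change Fintype.linearCombination R x v ∈ M
  rw [Fintype.linearCombination_apply]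
  exact hM v

end ExteriorAlgebra

open MvPolynomial

/-! ### Forms with polynomial coefficients and their top coefficient -/

section

variable {n : ℕ} {V : Type*} [AddCommGroup V] [Module ℂ V] (b : Module.Basis (Fin n) ℂ V)

/-- The one-form `∑ j, F j ⊗ y_j`, where the `y_j` are the basis of `V*` dual to `b`. -/
def covForm : (Fin n → Poly n) →ₗ[Poly n] Forms n V :=
  Fintype.linearCombination (Poly n) fun j =>
    ((1 : Poly n) ⊗ₜ[ℂ] ExteriorAlgebra.ι ℂ (b.dualBasis j) : Forms n V)

lemma covForm_apply (F : Fin n → Poly n) :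
    covForm b F = ∑ j, F j ⊗ₜ[ℂ] ExteriorAlgebra.ι ℂ (b.dualBasis j) := by
  rw [covForm, Fintype.linearCombination_apply]
  simp [TensorProduct.smul_tmul']

lemma covForm_mul_self (F : Fin n → Poly n) : covForm b F * covForm b F = 0 := by
  rw [covForm, Fintype.linearCombination_apply]
  refine IsAnticomm.sum_mul_self ⟨fun j => ?_, fun i j => ?_⟩ F _
  · rw [Algebra.TensorProduct.tmul_mul_tmul, ExteriorAlgebra.ι_sq_zero, TensorProduct.tmul_zero]
  · rw [Algebra.TensorProduct.tmul_mul_tmul, Algebra.TensorProduct.tmul_mul_tmul,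
      eq_neg_of_add_eq_zero_left (ExteriorAlgebra.ι_add_mul_swap _ _), TensorProduct.tmul_neg]

lemma isAnticomm_covForm {ι : Type*} (F : ι → Fin n → Poly n) :
    IsAnticomm fun i => covForm b (F i) where
  mul_self _ := covForm_mul_self b _
  mul_comm i j := by
    have h := covForm_mul_self b (F i + F j)
    rw [map_add, mul_add, add_mul, add_mul, covForm_mul_self, covForm_mul_self, zero_add,
      add_zero] at h
    exact eq_neg_of_add_eq_zero_right h

/-- The coefficient of `1 ⊗ y_1 ∧ … ∧ y_n`. -/
def topCoeff : Forms n V →ₗ[Poly n] Poly n :=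
  (TensorProduct.AlgebraTensorModule.rid ℂ (Poly n) (Poly n)).toLinearMap ∘ₗ
    (ExteriorAlgebra.liftAlternating (R := ℂ)
      (Pi.single (M := fun i => Module.Dual ℂ V [⋀^Fin i]→ₗ[ℂ] ℂ) n b.dualBasis.det)).baseChange
        (Poly n)

lemma topCoeff_tmul (f : Poly n) (x : ExteriorAlgebra ℂ (Module.Dual ℂ V)) :
    topCoeff b (f ⊗ₜ x) = ExteriorAlgebra.liftAlternating (R := ℂ)
      (Pi.single (M := fun i => Module.Dual ℂ V [⋀^Fin i]→ₗ[ℂ] ℂ) n b.dualBasis.det) x • f := by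
  simp [topCoeff]

/-- Exhibits a product of one-forms as an alternating multilinear function over `Poly n`, so that
its top coefficient can be computed on the standard basis alone. -/
lemma list_prod_covForm (l : List (Fin n → Poly n)) :
    (l.map (covForm b)).prod = ExteriorAlgebra.lift (Poly n) ⟨covForm b, covForm_mul_self b⟩
      (ExteriorAlgebra.ιMulti (Poly n) l.length l.get) := by
  rw [ExteriorAlgebra.ιMulti_apply, map_list_prod, List.map_ofFn]
  congr 1
  apply List.ext_get
  · simp
  · simp

lemma topCoeff_list_prod_eq_zero {l : List (Fin n → Poly n)} (hl : l.length ≠ n) :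
    topCoeff b (l.map (covForm b)).prod = 0 := by
  rw [list_prod_covForm]
  generalize l.get = v
  revert v
  generalize l.length = k at hl
  have h : ((topCoeff b).comp (ExteriorAlgebra.lift (Poly n)
      ⟨covForm b, covForm_mul_self b⟩).toLinearMap).compAlternatingMap
        (ExteriorAlgebra.ιMulti (Poly n) k) = 0 := by
    refine Module.Basis.ext_alternating (Pi.basisFun (Poly n) (Fin n)) fun v _ => ?_
    rw [LinearMap.compAlternatingMap_apply, LinearMap.comp_apply, AlgHom.toLinearMap_apply,
      ExteriorAlgebra.ιMulti_apply, map_list_prod, List.map_ofFn]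
    have h1 : (⇑(ExteriorAlgebra.lift (Poly n) ⟨covForm b, covForm_mul_self b⟩) ∘ fun i =>
        ExteriorAlgebra.ι (Poly n) ((Pi.basisFun (Poly n) (Fin n)) (v i))) =
        Algebra.TensorProduct.includeRight ∘ fun i =>
          (ExteriorAlgebra.ι ℂ (b.dualBasis (v i))) := by
      ext1 i
      simp [covForm, Fintype.linearCombination_apply_single]
    -- On basis vectors the product is 1 ⊗ x with x of exterior degree k ≠ n, where the functional
    -- defining `topCoeff` is zero.
    rw [h1, ← List.map_ofFn, ← map_list_prod, ← ExteriorAlgebra.ιMulti_apply,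
      Algebra.TensorProduct.includeRight_apply, topCoeff_tmul,
      ExteriorAlgebra.liftAlternating_apply_ιMulti, Pi.single_eq_of_ne hl]
    simp
  exact fun v => DFunLike.congr_fun h v

/-- An alternating n-form on the free module of rank n is the determinant times its value on the
standard basis, which is 1 here. -/
lemma topCoeff_ofFn_prod (M : Matrix (Fin n) (Fin n) (Poly n)) :
    topCoeff b ((List.finRange n).map fun i => covForm b (M i)).prod = M.det := by
  have h := AlternatingMap.eq_smul_basis_det (Pi.basisFun (Poly n) (Fin n))
    (((topCoeff b).comp (ExteriorAlgebra.lift (Poly n)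
      ⟨covForm b, covForm_mul_self b⟩).toLinearMap).compAlternatingMap
        (ExteriorAlgebra.ιMulti (Poly n) n))
  have h1 : ((topCoeff b).comp (ExteriorAlgebra.lift (Poly n)
      ⟨covForm b, covForm_mul_self b⟩).toLinearMap).compAlternatingMap
        (ExteriorAlgebra.ιMulti (Poly n) n) (Pi.basisFun (Poly n) (Fin n)) = 1 := by
    rw [LinearMap.compAlternatingMap_apply, LinearMap.comp_apply, AlgHom.toLinearMap_apply,
      ExteriorAlgebra.ιMulti_apply, map_list_prod, List.map_ofFn]
    have h1 : (⇑(ExteriorAlgebra.lift (Poly n) ⟨covForm b, covForm_mul_self b⟩) ∘ fun i =>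
        ExteriorAlgebra.ι (Poly n) ((Pi.basisFun (Poly n) (Fin n)) i)) =
        Algebra.TensorProduct.includeRight ∘ fun i =>
          (ExteriorAlgebra.ι ℂ (b.dualBasis i)) := by
      ext1 i
      simp [covForm, Fintype.linearCombination_apply_single]
    rw [h1, ← List.map_ofFn, ← map_list_prod, ← ExteriorAlgebra.ιMulti_apply,
      Algebra.TensorProduct.includeRight_apply, topCoeff_tmul,
      ExteriorAlgebra.liftAlternating_apply_ιMulti, Pi.single_eq_same, Module.Basis.det_self,
      one_smul]
  rw [h1, one_smul, Pi.basisFun_det] at h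
  have h2 : ∀ v : Fin n → Fin n → Poly n,
      topCoeff b ((List.finRange n).map fun i => covForm b (v i)).prod =
        Matrix.detRowAlternating v := by
    intro v
    rw [← h, LinearMap.compAlternatingMap_apply, LinearMap.comp_apply,
      AlgHom.toLinearMap_apply, ExteriorAlgebra.ιMulti_apply,
      map_list_prod (ExteriorAlgebra.lift (Poly n) _), List.map_ofFn, ← List.ofFn_eq_map]
    congr 3
    ext1 i
    simp
  exact h2 M

lemma topCoeff_wedge (M : Matrix (Fin n) (Fin n) (Poly n)) :
    topCoeff b (wedge (fun i => covForm b (M i)) Finset.univ) = M.det ∨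
      topCoeff b (wedge (fun i => covForm b (M i)) Finset.univ) = -M.det := by
  have hp : (Finset.univ : Finset (Fin n)).toList.Perm (List.finRange n) :=
    (List.perm_ext_iff_of_nodup (Finset.nodup_toList _) (List.nodup_finRange n)).2 (by simp)
  rw [← topCoeff_ofFn_prod b M, ← map_neg]
  rcases (isAnticomm_covForm b M).prod_perm hp with h | h
  · exact Or.inl (congrArg _ h)
  · exact Or.inr (congrArg _ h)

lemma topCoeff_wedge_eq_zero (M : Matrix (Fin n) (Fin n) (Poly n)) {I : Finset (Fin n)}
    (hI : I ≠ Finset.univ) : topCoeff b (wedge (fun i => covForm b (M i)) I) = 0 := by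
  have h1 : wedge (fun i => covForm b (M i)) I =
      ((I.toList.map fun i => M i).map (covForm b)).prod := by
    simp [wedge, Function.comp_def]
  rw [h1]
  refine topCoeff_list_prod_eq_zero b fun h => hI ?_
  rw [List.length_map, Finset.length_toList] at h
  rw [← Finset.card_eq_iff_eq_univ, h, Fintype.card_fin]

/-- Over the fraction field the one-forms given by the rows generate all forms: by the adjugate,
`M.det` times any one-form is a combination of them, and one-forms generate the algebra. -/
lemma exists_smul_mem_adjoin {M : Matrix (Fin n) (Fin n) (Poly n)} (hM : M.det ≠ 0)
    (y : Forms n V) : ∃ s : Poly n, s ≠ 0 ∧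
      s • y ∈ Algebra.adjoin (Poly n) (Set.range fun i => covForm b (M i)) := by
  set N := Algebra.adjoin (Poly n) (Set.range fun i => covForm b (M i))
  have hadd : ∀ y₁ y₂ : Forms n V, (∃ s : Poly n, s ≠ 0 ∧ s • y₁ ∈ N) →
      (∃ s : Poly n, s ≠ 0 ∧ s • y₂ ∈ N) → ∃ s : Poly n, s ≠ 0 ∧ s • (y₁ + y₂) ∈ N := by
    rintro y₁ y₂ ⟨s₁, h₁, hs₁⟩ ⟨s₂, h₂, hs₂⟩
    refine ⟨s₁ * s₂, mul_ne_zero h₁ h₂, ?_⟩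
    rw [smul_add]
    refine N.add_mem ?_ ?_
    · rw [mul_comm, mul_smul]
      exact N.smul_mem hs₁ _
    · rw [mul_smul]
      exact N.smul_mem hs₂ _
  have hcov : ∀ F, M.det • covForm b F ∈ N := by
    intro F
    have h : M.det • F = ∑ i, Matrix.vecMul F M.adjugate i • M i := by
      rw [← Matrix.vecMul_eq_sum, Matrix.vecMul_vecMul, Matrix.adjugate_mul, Matrix.vecMul_smul,
        Matrix.vecMul_one]
    rw [← map_smul, h, map_sum]
    refine N.sum_mem fun i _ => ?_
    rw [map_smul]
    exact N.smul_mem (Algebra.subset_adjoin ⟨i, rfl⟩) _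
  have hx : ∀ x : ExteriorAlgebra ℂ (Module.Dual ℂ V),
      ∃ s : Poly n, s ≠ 0 ∧ s • ((1 : Poly n) ⊗ₜ[ℂ] x : Forms n V) ∈ N := by
    intro x
    induction x using ExteriorAlgebra.induction with
    | algebraMap c =>
      refine ⟨1, one_ne_zero, ?_⟩
      rw [one_smul, Algebra.algebraMap_eq_smul_one, ← TensorProduct.smul_tmul,
        ← mul_one (c • (1 : Poly n)), ← smul_eq_mul, ← TensorProduct.smul_tmul']
      exact N.smul_mem N.one_mem _
    | ι v =>
      refine ⟨M.det, hM, ?_⟩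
      convert hcov fun j => C (b.dualBasis.repr v j) using 2
      conv_lhs => rw [← b.dualBasis.sum_repr v]
      rw [covForm_apply, map_sum, TensorProduct.tmul_sum]
      refine Finset.sum_congr rfl fun j _ => ?_
      rw [map_smul, ← TensorProduct.smul_tmul, smul_eq_C_mul, mul_one]
    | mul x₁ x₂ ih₁ ih₂ =>
      obtain ⟨s₁, h₁, hs₁⟩ := ih₁
      obtain ⟨s₂, h₂, hs₂⟩ := ih₂
      refine ⟨s₁ * s₂, mul_ne_zero h₁ h₂, ?_⟩
      rw [← mul_one (1 : Poly n), ← Algebra.TensorProduct.tmul_mul_tmul, ← smul_mul_smul_comm]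
      exact N.mul_mem hs₁ hs₂
    | add x₁ x₂ ih₁ ih₂ =>
      rw [TensorProduct.tmul_add]
      exact hadd _ _ ih₁ ih₂
  induction y using TensorProduct.induction_on with
  | zero => exact ⟨1, one_ne_zero, by simp⟩
  | tmul f x =>
    obtain ⟨s, h, hs⟩ := hx x
    refine ⟨s, h, ?_⟩
    rw [← mul_one f, ← smul_eq_mul, ← TensorProduct.smul_tmul', smul_comm]
    exact N.smul_mem hs f
  | add y₁ y₂ ih₁ ih₂ => exact hadd _ _ ih₁ ih₂

variable (W : Subgroup (GL (Fin n) ℂ)) (ρ : Representation ℂ W V)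

lemma topCoeff_formsAct (w : W) (y : Forms n V) :
    topCoeff b (formsAct W ρ w y) = LinearMap.det (ρ.dual w) • polyAct n w (topCoeff b y) := by
  induction y using TensorProduct.induction_on with
  | zero => simp
  | tmul f x =>
    have h : ExteriorAlgebra.liftAlternating (R := ℂ)
        (Pi.single (M := fun i => Module.Dual ℂ V [⋀^Fin i]→ₗ[ℂ] ℂ) n b.dualBasis.det) ∘ₗ
          (ExteriorAlgebra.map (ρ.dual w)).toLinearMap =
        LinearMap.det (ρ.dual w) • ExteriorAlgebra.liftAlternating (R := ℂ)
        (Pi.single (M := fun i => Module.Dual ℂ V [⋀^Fin i]→ₗ[ℂ] ℂ) n b.dualBasis.det) := by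
      refine ExteriorAlgebra.lhom_ext fun i => ?_
      ext v
      simp only [LinearMap.compAlternatingMap_apply, LinearMap.comp_apply,
        AlgHom.toLinearMap_apply, ExteriorAlgebra.map_apply_ιMulti, LinearMap.smul_apply,
        ExteriorAlgebra.liftAlternating_apply_ιMulti]
      by_cases hi : i = n
      · subst hi
        rw [Pi.single_eq_same, Module.Basis.det_comp, smul_eq_mul]
      · simp [Pi.single_eq_of_ne hi]
    have h1 : formsAct W ρ w (f ⊗ₜ x) = polyAct n w f ⊗ₜ ExteriorAlgebra.map (ρ.dual w) x := rfl
    rw [h1, topCoeff_tmul, topCoeff_tmul, map_smul, smul_smul]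
    congr 1
    exact LinearMap.congr_fun h x
  | add y₁ y₂ ih₁ ih₂ => rw [map_add, map_add, ih₁, ih₂, map_add, map_add, smul_add]

end

/-! ### Freeness of V -/

section

variable {r p n m : ℕ} (hm : m ≠ 0)

lemma IsEntries.ne_zero (hr : 0 < r) {a : Fin n → ℂ} (ha : IsEntries r p a) (i : Fin n) :
    a i ≠ 0 := fun h => by
  have := ha.1 i
  simp [h, hr.ne'] at this

lemma powerRep_inv_apply_powerBasis (hr : 0 < r) (w : G r p n) {σ : Equiv.Perm (Fin n)}
    {a : Fin n → ℂ} (ha : IsEntries r p a) (hact : ActsMonomially w σ a) (i : Fin n) :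
    (powerRep r p n m).toRepresentation w⁻¹ (powerBasis r p n hm (σ i)) =
      (a i ^ m)⁻¹ • powerBasis r p n hm i := by
  rw [eq_inv_smul_iff₀ (pow_ne_zero _ (ha.ne_zero hr i)), ← map_smul,
    ← powerRep_apply_powerBasis hm w hact]
  exact Representation.inv_self_apply _ w _

lemma dual_powerRep_apply_dualBasis (hr : 0 < r) (w : G r p n) {σ : Equiv.Perm (Fin n)}
    {a : Fin n → ℂ} (ha : IsEntries r p a) (hact : ActsMonomially w σ a) (j : Fin n) :
    (powerRep r p n m).toRepresentation.dual w ((powerBasis r p n hm).dualBasis j) =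
      (a j ^ m)⁻¹ • (powerBasis r p n hm).dualBasis (σ j) := by
  refine (powerBasis r p n hm).ext fun i => ?_
  obtain ⟨i, rfl⟩ := σ.surjective i
  rw [Representation.dual_apply, Module.Dual.transpose_apply, LinearMap.comp_apply,
    powerRep_inv_apply_powerBasis hm hr w ha hact, map_smul, LinearMap.smul_apply]
  simp only [Module.Basis.dualBasis_apply_self, σ.injective.eq_iff]
  split_ifs with h
  · rw [h]
  · simp

lemma det_dual_powerRep (hm : m ≠ 0) (hr : 0 < r) (w : G r p n) {σ : Equiv.Perm (Fin n)}
    {a : Fin n → ℂ} (ha : IsEntries r p a) (hact : ActsMonomially w σ a) :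
    LinearMap.det ((powerRep r p n m).toRepresentation.dual w) =
      (Equiv.Perm.sign σ : ℤ) * ((∏ i, a i) ^ m)⁻¹ := by
  set e := (powerBasis r p n hm).dualBasis
  have h := Module.Basis.det_comp e ((powerRep r p n m).toRepresentation.dual w) e
  rw [e.det_self, mul_one] at h
  rw [← h, show (⇑((powerRep r p n m).toRepresentation.dual w) ∘ ⇑e) =
    fun j => (a j ^ m)⁻¹ • e (σ j) from
      funext fun j => dual_powerRep_apply_dualBasis hm hr w ha hact j,
    AlternatingMap.map_smul_univ, show (fun j => e (σ j)) = e ∘ σ from rfl,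
    AlternatingMap.map_perm, e.det_self, Finset.prod_inv_distrib, Finset.prod_pow, mul_comm]
  rcases Int.units_eq_one_or (Equiv.Perm.sign σ) with h | h <;> simp [h]

lemma IsCovariant.covForm_mem (hr : 0 < r) {F : Fin n → Poly n} (hF : IsCovariant r p m F) :
    covForm (powerBasis r p n hm) F ∈
      invariantForms (G r p n) (powerRep r p n m).toRepresentation := by
  intro w
  obtain ⟨σ, a, ha, hact⟩ := exists_actsMonomially w.2
  rw [covForm_apply, map_sum]
  refine Fintype.sum_equiv σ _ _ fun j => ?_
  change polyAct n w (F j) ⊗ₜ[ℂ] ExteriorAlgebra.map _ (ExteriorAlgebra.ι ℂ _) = _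
  rw [ExteriorAlgebra.map_apply_ι, dual_powerRep_apply_dualBasis hm hr w ha hact,
    hF w w.2 σ a ha hact, map_smul, TensorProduct.tmul_smul, ← TensorProduct.smul_tmul', smul_smul,
    inv_mul_cancel₀ (pow_ne_zero _ (ha.ne_zero hr j)), one_smul]

/-- On the top exterior power of V* the element w acts by sign(σ) (∏ a_i)^(-m), so the coefficient
of an invariant form must carry the inverse character. -/
lemma isSemiinvariant_topCoeff (hr : 0 < r) {y : Forms n (powerRep r p n m).toSubmodule}
    (hy : y ∈ invariantForms (G r p n) (powerRep r p n m).toRepresentation) :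
    IsSemiinvariant r p m (topCoeff (powerBasis r p n hm) y) := by
  intro w hw σ a ha hact
  have h := topCoeff_formsAct (powerBasis r p n hm) (G r p n)
    (powerRep r p n m).toRepresentation ⟨w, hw⟩ y
  rw [hy ⟨w, hw⟩, det_dual_powerRep hm hr ⟨w, hw⟩ ha hact] at h
  have h0 : (∏ i, a i) ^ m ≠ 0 :=
    pow_ne_zero _ (Finset.prod_ne_zero_iff.2 fun i _ => ha.ne_zero hr i)
  conv_rhs => rw [h, smul_smul]
  rcases Int.units_eq_one_or (Equiv.Perm.sign σ) with h | h <;> simp [h, h0]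

lemma invariantRing_smul_eq {V : Type*} [AddCommGroup V] [Module ℂ V]
    {W : Subgroup (GL (Fin n) ℂ)} (c : invariantRing W) (y : Forms n V) :
    c • y = (c : Poly n) • y := by
  induction y using TensorProduct.induction_on with
  | zero => simp
  | tmul f x => rfl
  | add y₁ y₂ h₁ h₂ => rw [smul_add, smul_add, h₁, h₂]

lemma covForm_mem_oneForms {V : Type*} [AddCommGroup V] [Module ℂ V]
    (b : Module.Basis (Fin n) ℂ V) (F : Fin n → Poly n) : covForm b F ∈ oneForms n V :=
  ⟨∑ j, F j ⊗ₜ[ℂ] b.dualBasis j, by rw [map_sum, covForm_apply]; rfl⟩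

end

instance {n : ℕ} (W : Subgroup (GL (Fin n) ℂ)) {V : Type*} [AddCommGroup V] [Module ℂ V]
    (ρ : Representation ℂ W V) : Module (invariantRing W) (invariantForms W ρ) :=
  Algebra.toModule

instance {n : ℕ} (W : Subgroup (GL (Fin n) ℂ)) {V : Type*} [AddCommGroup V] [Module ℂ V]
    (ρ : Representation ℂ W V) : SMul (invariantRing W) (invariantForms W ρ) :=
  Algebra.toSMul

lemma coe_sum_smul_invariantForms {n : ℕ} {W : Subgroup (GL (Fin n) ℂ)} {V : Type*}
    [AddCommGroup V] [Module ℂ V] {ρ : Representation ℂ W V} {ι : Type*} (s : Finset ι)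
    (c : ι → invariantRing W) (y : ι → invariantForms W ρ) :
    ((∑ i ∈ s, c i • y i : invariantForms W ρ) : Forms n V) =
      ∑ i ∈ s, (c i : Poly n) • (y i : Forms n V) := by
  rw [AddSubmonoidClass.coe_finsetSum]
  exact Finset.sum_congr rfl fun i _ => invariantRing_smul_eq _ _

/-- Solomon's criterion: `V` is free if the coefficient matrix of some invariant one-forms has a
non-zero determinant, which divides the top coefficient of each invariant form with an invariant
quotient. -/
theorem isFreeRep_of_covForm {n : ℕ} {W : Subgroup (GL (Fin n) ℂ)} {V : Type*} [AddCommGroup V]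
    [Module ℂ V] {ρ : Representation ℂ W V} (b : Module.Basis (Fin n) ℂ V)
    {M : Matrix (Fin n) (Fin n) (Poly n)} (hdet : M.det ≠ 0)
    (hM : ∀ i, covForm b (M i) ∈ invariantForms W ρ)
    (hdvd : ∀ y ∈ invariantForms W ρ, ∃ u ∈ invariantRing W, topCoeff b y = M.det * u) :
    IsFreeRep W ρ := by
  have hfin : Module.finrank ℂ V = n := by
    rw [Module.finrank_eq_card_basis b, Fintype.card_fin]
  rw [IsFreeRep, hfin]
  let x : Fin n → invariantForms W ρ := fun i => ⟨covForm b (M i), hM i⟩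
  have hanti := isAnticomm_covForm b M
  have hx : IsAnticomm x :=
    ⟨fun i => Subtype.ext (hanti.mul_self i), fun i j => Subtype.ext (hanti.mul_comm i j)⟩
  have hwedge : ∀ I, ((wedge x I : invariantForms W ρ) : Forms n V) =
      wedge (fun i => covForm b (M i)) I := fun I => map_wedge (invariantForms W ρ).val I
  have htop : ∀ I ≠ Finset.univ, topCoeff b (wedge (fun i => covForm b (M i)) I) = 0 :=
    fun I hI => topCoeff_wedge_eq_zero b M hI
  have hD := topCoeff_wedge b M
  have h0 : topCoeff b (wedge (fun i => covForm b (M i)) Finset.univ) ≠ 0 := by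
    rcases hD with h | h <;> simp [h, hdet]
  refine isFreeExterior_of_wedge hx (fun v => ?_) (fun c hc => ?_) fun y => ?_
  · have h : covForm b (∑ i, (v i : Poly n) • M i) ∈ oneForms n V := covForm_mem_oneForms b _
    rw [map_sum] at h
    change ((∑ i, v i • x i : invariantForms W ρ) : Forms n V) ∈ oneForms n V
    rw [coe_sum_smul_invariantForms]
    simpa only [map_smul] using h
  · have h1 := hanti.wedge_linearIndependent htop h0 (c := fun I => (c I : Poly n)) (by
      have h := congrArg Subtype.val hc
      rw [coe_sum_smul_invariantForms] at h
      simp only [hwedge] at h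
      exact h)
    ext1 I
    exact Subtype.ext (congrFun h1 I)
  · obtain ⟨s, hs, hsy⟩ := exists_smul_mem_adjoin b hdet (y : Forms n V)
    obtain ⟨c, hc⟩ := hanti.exists_eq_sum_wedge htop h0 (R := (invariantRing W).toSubring) hs
      (hanti.mem_span_wedge hsy) fun J => by
        -- The product of invariant forms is invariant, so `hdvd` applies to its top coefficient.
        have hmem : (y : Forms n V) * wedge (fun i => covForm b (M i)) J ∈
            invariantForms W ρ := by
          rw [← hwedge]
          exact mul_mem y.2 (wedge x J).2
        obtain ⟨u, hu, h⟩ := hdvd _ hmem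
        rcases hD with hD | hD
        · exact ⟨u, hu, by rw [hD]; exact h⟩
        · exact ⟨-u, neg_mem hu, by rw [hD, neg_mul_neg]; exact h⟩
    refine ⟨c, Subtype.ext (hc.trans ?_)⟩
    rw [coe_sum_smul_invariantForms]
    simp only [hwedge]

theorem powerRep_isFreeRep {r p k m : ℕ} (hr : 0 < r) (hpr : p ∣ r) (hm : m ≠ 0) :
    IsFreeRep (G r p (k + 1)) (powerRep r p (k + 1) m).toRepresentation :=
  isFreeRep_of_covForm (powerBasis r p (k + 1) hm) (det_covMatrix_ne_zero hr)
    (fun i => (covMatrix_isCovariant hr hpr i).covForm_mem hm hr)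
    fun _ hy => (isSemiinvariant_topCoeff hm hr hy).exists_eq_mul hr hpr

/-! ### Basic invariants and degrees -/

/-- Basic invariants of `G(r,p,k+1)`: the power `(x_1 ⋯ x_n)^(r/p)` and the elementary symmetric
polynomials of degree less than `n = k + 1` in the `x_i^r`. -/
def basicInvariant (r p k : ℕ) : Fin (k + 1) → Poly (k + 1) :=
  Fin.cases ((∏ i, X i) ^ (r / p)) fun i : Fin k => expand r (esymm (Fin (k + 1)) ℂ (i + 1))

section

variable {r p n k : ℕ}

lemma isHomogeneous_expand {f : Poly n} {d : ℕ} (hf : f.IsHomogeneous d) :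
    (expand r f).IsHomogeneous (r * d) :=
  hf.aeval _ fun i => by simpa using (isHomogeneous_X ℂ i).pow r

lemma isHomogeneous_esymm (i : ℕ) : (esymm (Fin n) ℂ i).IsHomogeneous i := by
  refine IsHomogeneous.sum _ _ _ fun t ht => ?_
  have := IsHomogeneous.prod t (fun i => (X i : Poly n)) (fun _ => 1) fun i _ => isHomogeneous_X ℂ i
  rwa [Finset.sum_const, smul_eq_mul, mul_one, (Finset.mem_powersetCard.1 ht).2] at this

lemma isHomogeneous_prod_X : (∏ i, X i : Poly n).IsHomogeneous n := by
  simpa using IsHomogeneous.prod Finset.univ (fun i => (X i : Poly n)) (fun _ => 1)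
    fun i _ => isHomogeneous_X ℂ i

lemma polyAct_expand {w : GL (Fin n) ℂ} {σ : Equiv.Perm (Fin n)} {a : Fin n → ℂ}
    (ha : ∀ i, a i ^ r = 1) (hact : ActsMonomially w σ a) (f : Poly n) :
    polyAct n w (expand r f) = expand r (rename σ f) := by
  suffices h : (polyAct n w).comp (expand r) = (expand r).comp (rename σ) from
    DFunLike.congr_fun h f
  apply MvPolynomial.algHom_ext
  intro i
  simp only [AlgHom.comp_apply, expand_X, rename_X, map_pow]
  rw [hact, smul_pow, ha, one_smul]

lemma expand_mem_invariantRing {f : Poly n} (hf : f.IsSymmetric) :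
    expand r f ∈ invariantRing (G r p n) := fun w => by
  obtain ⟨σ, a, ha, hact⟩ := exists_actsMonomially w.2
  rw [polyAct_expand ha.1 hact, hf]

lemma prod_X_pow_mem_invariantRing :
    (∏ i, X i) ^ (r / p) ∈ invariantRing (G r p n) := fun w => by
  obtain ⟨σ, a, ha, hact⟩ := exists_actsMonomially w.2
  rw [map_pow, map_prod]
  simp only [hact _]
  rw [Finset.prod_smul, smul_pow, ha.2, one_smul, Equiv.prod_comp σ (fun i => (X i : Poly n))]

lemma basicInvariant_mem (i : Fin (k + 1)) :
    basicInvariant r p k i ∈ invariantRing (G r p (k + 1)) := by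
  refine Fin.cases ?_ (fun i => ?_) i
  · exact prod_X_pow_mem_invariantRing
  · exact expand_mem_invariantRing (esymm_isSymmetric _ _ _)

lemma esymm_card_eq_prod : esymm (Fin n) ℂ n = ∏ i, X i := by
  have h := Finset.powersetCard_self (Finset.univ : Finset (Fin n))
  rw [Finset.card_univ, Fintype.card_fin] at h
  rw [esymm, h, Finset.sum_singleton]

lemma expand_mem_adjoin_basicInvariant (hpr : p ∣ r) {f : Poly (k + 1)} (hf : f.IsSymmetric) :
    expand r f ∈ Algebra.adjoin ℂ (Set.range (basicInvariant r p k)) := by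
  obtain ⟨Q, hQ⟩ := esymmAlgHom_surjective (σ := Fin (k + 1)) ℂ (n := k + 1) (by simp)
    ⟨f, hf⟩
  have hQ' : f = aeval (fun i : Fin (k + 1) => esymm (Fin (k + 1)) ℂ (i + 1)) Q := by
    rw [← esymmAlgHom_apply, hQ]
  rw [hQ', ← AlgHom.comp_apply, comp_aeval]
  have h : ∀ i : Fin (k + 1), expand r (esymm (Fin (k + 1)) ℂ (i + 1)) ∈
      Algebra.adjoin ℂ (Set.range (basicInvariant r p k)) := by
    refine Fin.lastCases ?_ fun i => ?_
    -- The top elementary symmetric polynomial in the x_i^r is not itself a basic invariant, but the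
    -- p-th power of (x_1⋯x_n)^(r/p).
    · rw [Fin.val_last, esymm_card_eq_prod, map_prod]
      simp only [expand_X]
      rw [Finset.prod_pow, show (∏ i, X i : Poly (k + 1)) ^ r = ((∏ i, X i) ^ (r / p)) ^ p by
        rw [← pow_mul, Nat.div_mul_cancel hpr]]
      exact pow_mem (Algebra.subset_adjoin (R := ℂ)
        (Set.mem_range_self (f := basicInvariant r p k) 0)) _
    · exact Algebra.subset_adjoin (Set.mem_range_self i.succ)
  have hQr := AlgHom.mem_range_self
    (aeval fun i : Fin (k + 1) => expand r (esymm (Fin (k + 1)) ℂ (i + 1))) Q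
  rw [← Algebra.adjoin_range_eq_range_aeval] at hQr
  exact Algebra.adjoin_le (Set.range_subset_iff.2 h) hQr

lemma prod_pow_eq_one_of_coeff_ne_zero (hr : 0 < r) {f : Poly n} (hf : f ∈ invariantRing (G r p n))
    {d : Fin n →₀ ℕ} (hd : coeff d f ≠ 0) {a : Fin n → ℂ} (ha : IsEntries r p a) :
    ∏ i, a i ^ d i = 1 := by
  obtain ⟨w, hw, hact⟩ := exists_mem_actsMonomially hr.ne' 1 ha
  have h := congrArg (coeff d) (hf ⟨w, hw⟩)
  rw [polyAct_monomial_of_diag hact, Finsupp.prod_fintype _ _ (by simp)] at h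
  exact mul_right_cancel₀ hd (h.trans (one_mul _).symm)

/-- Entries ζ, ζ⁻¹ at j, i show that d_i = 0 forces r ∣ d_j for all j. Hence d_i is positive, and
the entry ζ^p at i shows that it is a multiple of r/p. -/
lemma le_of_coeff_ne_zero (hr : 0 < r) (hpr : p ∣ r) {f : Poly n}
    (hf : f ∈ invariantRing (G r p n)) {d : Fin n →₀ ℕ} (hd : coeff d f ≠ 0)
    (hdvd : ¬ ∀ i, r ∣ d i) (i : Fin n) : r / p ≤ d i := by
  obtain ⟨ζ, hζ⟩ : ∃ ζ : ℂ, IsPrimitiveRoot ζ r := ⟨_, Complex.isPrimitiveRoot_exp r hr.ne'⟩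
  have h0 : ζ ≠ 0 := hζ.ne_zero hr.ne'
  have hζp : IsPrimitiveRoot (ζ ^ p) (r / p) := hζ.pow hr (Nat.mul_div_cancel' hpr).symm
  refine Nat.le_of_dvd (Nat.pos_of_ne_zero fun hi => hdvd fun j => ?_) ?_
  · by_cases hj : j = i
    · rw [hj, hi]
      exact dvd_zero r
    have ha : IsEntries r p fun l : Fin n => if l = j then ζ else if l = i then ζ⁻¹ else 1 := by
      refine ⟨fun l => ?_, ?_⟩
      · dsimp only
        split_ifs <;> simp [hζ.pow_eq_one]
      · rw [← Finset.prod_subset (Finset.subset_univ {j, i})]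
        · rw [Finset.prod_pair hj]
          simp [Ne.symm hj, h0]
        · intro l _ hl
          simp only [Finset.mem_insert, Finset.mem_singleton, not_or] at hl
          simp [hl]
    have h := prod_pow_eq_one_of_coeff_ne_zero hr hf hd ha
    rw [Finset.prod_eq_single j] at h
    · rw [if_pos rfl] at h
      exact hζ.dvd_of_pow_eq_one _ h
    · intro l _ hl
      rw [if_neg hl]
      split_ifs with hli
      · rw [hli, hi, pow_zero]
      · rw [one_pow]
    · simp
  · have ha : IsEntries r p (Pi.mulSingle i (ζ ^ p) : Fin n → ℂ) := by
      refine ⟨fun l => ?_, ?_⟩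
      · rw [Pi.mulSingle_apply]
        split_ifs
        · rw [pow_right_comm, hζ.pow_eq_one, one_pow]
        · simp
      · rw [Fintype.prod_pi_mulSingle', hζp.pow_eq_one]
    have h := prod_pow_eq_one_of_coeff_ne_zero hr hf hd ha
    rw [Finset.prod_eq_single i (fun l _ hl => by simp [Pi.mulSingle_eq_of_ne hl]) (by simp),
      Pi.mulSingle_eq_same] at h
    exact hζp.dvd_of_pow_eq_one _ h

lemma rename_eq_of_mem_invariantRing (hr : 0 < r) {f : Poly n}
    (hf : f ∈ invariantRing (G r p n)) : f.IsSymmetric := fun σ => by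
  obtain ⟨w, hw, hact⟩ := exists_mem_actsMonomially (r := r) (p := p) hr.ne' σ
    (a := fun _ => 1) ⟨by simp, by simp⟩
  have h : polyAct n w = rename σ := by
    apply MvPolynomial.algHom_ext
    intro i
    rw [hact, one_smul, rename_X]
  rw [← h]
  exact hf ⟨w, hw⟩

/-- The part of `f` in which all exponents are divisible by `r` is a polynomial in the `x_i^r`. -/
lemma exists_coeff_smul_eq (hr : 0 < r) (f : Poly n) :
    ∃ g : Poly n, ∀ e, coeff e g = coeff (r • e) f := by
  have hinj : Function.Injective fun e : Fin n →₀ ℕ => r • e := fun e₁ e₂ h => by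
    ext i
    have := DFunLike.congr_fun h i
    simpa [hr.ne'] using this
  refine ⟨∑ e ∈ f.support.preimage _ hinj.injOn, monomial e (coeff (r • e) f), fun e => ?_⟩
  rw [coeff_sum]
  simp only [coeff_monomial, Finset.sum_ite_eq', Finset.mem_preimage, mem_support_iff]
  split_ifs with h
  · rfl
  · exact (not_not.1 h).symm

/-- Induction on the degree. The monomials of f whose exponents are all divisible by r form a
symmetric polynomial in the x_i^r. The rest is divisible by (x_1⋯x_n)^(r/p), with an invariant
quotient of smaller degree. -/
lemma mem_adjoin_basicInvariant (hr : 0 < r) (hpr : p ∣ r) {f : Poly (k + 1)}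
    (hf : f ∈ invariantRing (G r p (k + 1))) :
    f ∈ Algebra.adjoin ℂ (Set.range (basicInvariant r p k)) := by
  induction hN : f.totalDegree using Nat.strong_induction_on generalizing f with
  | _ N ih =>
  obtain ⟨g, hg⟩ := exists_coeff_smul_eq hr f
  have hgs : g.IsSymmetric := fun σ => by
    ext d
    obtain ⟨e, rfl⟩ : ∃ e, d = Finsupp.mapDomain σ e :=
      ⟨Finsupp.mapDomain σ.symm d, by rw [← Finsupp.mapDomain_comp]; simp⟩
    rw [coeff_rename_mapDomain _ σ.injective, hg, hg, ← Finsupp.mapDomain_smul,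
      ← coeff_rename_mapDomain σ σ.injective f, rename_eq_of_mem_invariantRing hr hf σ]
  have hcoeff : ∀ d, coeff d (f - expand r g) = if ∀ i, r ∣ d i then 0 else coeff d f := by
    intro d
    split_ifs with hd
    · obtain ⟨e, rfl⟩ : ∃ e : Fin (k + 1) →₀ ℕ, d = r • e := by
        choose e he using hd
        exact ⟨Finsupp.equivFunOnFinite.symm e, by ext i; simp [he]⟩
      rw [coeff_sub, coeff_expand_smul _ hr.ne', hg, sub_self]
    · push Not at hd
      obtain ⟨i, hi⟩ := hd
      rw [coeff_sub, coeff_expand_of_not_dvd _ hi, sub_zero]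
  have hmem : f - expand r g ∈ invariantRing (G r p (k + 1)) :=
    sub_mem hf (expand_mem_invariantRing hgs)
  have hdvd : (∏ i, X i) ^ (r / p) ∣ f - expand r g := by
    rw [← Finset.prod_pow]
    refine Fintype.prod_dvd_of_isRelPrime (fun c d hcd => ?_) fun c =>
      X_pow_dvd_of_coeff fun d hd => ?_
    · refine IsRelPrime.pow ?_
      rw [(irreducible_X c).isRelPrime_iff_not_dvd]
      rintro ⟨g, hg⟩
      have h1 := congrArg (MvPolynomial.eval (Pi.single d (1 : ℂ))) hg
      simp [hcd] at h1
    · refine le_of_coeff_ne_zero hr hpr hmem hd (fun h => hd ?_) c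
      rw [hcoeff, if_pos h]
  obtain ⟨u, hu⟩ := hdvd
  have hE0 : (∏ i, X i : Poly (k + 1)) ^ (r / p) ≠ 0 :=
    pow_ne_zero _ (Finset.prod_ne_zero_iff.2 fun j _ => X_ne_zero j)
  have humem : u ∈ invariantRing (G r p (k + 1)) := fun w => by
    have h := hmem w
    rw [hu, map_mul, prod_X_pow_mem_invariantRing w] at h
    exact mul_left_cancel₀ hE0 h
  have hu' : u ∈ Algebra.adjoin ℂ (Set.range (basicInvariant r p k)) := by
    by_cases hu0 : u = 0
    · rw [hu0]
      exact zero_mem _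
    refine ih _ ?_ humem rfl
    have h1 : (f - expand r g).totalDegree ≤ f.totalDegree := by
      refine totalDegree_le_of_support_subset fun d hd => ?_
      rw [mem_support_iff, hcoeff] at hd
      split_ifs at hd
      · exact absurd rfl hd
      · exact mem_support_iff.2 hd
    rw [hu, totalDegree_mul_of_isDomain hE0 hu0,
      (isHomogeneous_prod_X.pow _).totalDegree hE0, hN] at h1
    have := Nat.mul_pos (Nat.add_one_pos k) (Nat.div_pos (Nat.le_of_dvd hr hpr) (Nat.pos_of_dvd_of_pos hpr hr))
    omega
  rw [← sub_add_cancel f (expand r g), hu]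
  exact add_mem (mul_mem (Algebra.subset_adjoin (Set.mem_range_self 0)) hu')
    (expand_mem_adjoin_basicInvariant hpr hgs)

/-- Replacing (x_1⋯x_n)^(r/p) by its p-th power gives the elementary symmetric polynomials in the
x_i^r, which are independent. An element whose p-th power is transcendental over the others is
itself transcendental over them. -/
lemma basicInvariant_algebraicIndependent (hr : 0 < r) (hpr : p ∣ r) :
    AlgebraicIndependent ℂ (basicInvariant r p k) := by
  let y : Fin (k + 1) → Poly (k + 1) := fun i => expand r (esymm (Fin (k + 1)) ℂ (i + 1))
  have hy : AlgebraicIndependent ℂ y := by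
    rw [algebraicIndependent_iff_injective_aeval]
    have h : (aeval y : Poly (k + 1) →ₐ[ℂ] Poly (k + 1)) = ((expand r).comp
        (symmetricSubalgebra (Fin (k + 1)) ℂ).val).comp (esymmAlgHom (Fin (k + 1)) ℂ (k + 1)) := by
      apply MvPolynomial.algHom_ext
      intro i
      simp [y, esymmAlgHom]
    rw [h, AlgHom.coe_comp, AlgHom.coe_comp]
    exact (Function.Injective.comp (expand_injective hr) Subtype.val_injective).comp
      (esymmAlgHom_injective ℂ (by simp))
  let x : Fin k → Poly (k + 1) := fun i => expand r (esymm (Fin (k + 1)) ℂ (i + 1))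
  have h1 : AlgebraicIndependent ℂ fun o : Option (Fin k) =>
      o.elim (((∏ i, X i : Poly (k + 1)) ^ (r / p)) ^ p) x := by
    rw [← algebraicIndependent_equiv finSuccEquivLast]
    convert hy using 1
    ext1 i
    refine Fin.lastCases ?_ (fun i => ?_) i
    · simp only [Function.comp_apply, finSuccEquivLast_last, Option.elim_none, y, Fin.val_last]
      rw [esymm_card_eq_prod, map_prod]
      simp only [expand_X]
      rw [Finset.prod_pow, ← pow_mul, Nat.div_mul_cancel hpr]
    · simp [x, y]
  rw [AlgebraicIndependent.option_iff] at h1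
  have h2 : AlgebraicIndependent ℂ fun o : Option (Fin k) =>
      o.elim ((∏ i, X i : Poly (k + 1)) ^ (r / p)) x :=
    AlgebraicIndependent.option_iff.2 ⟨h1.1, fun h => h1.2 (h.pow p)⟩
  rw [← algebraicIndependent_equiv (finSuccEquiv k)] at h2
  convert h2 using 1
  ext1 i
  refine Fin.cases ?_ (fun i => ?_) i
  · simp [basicInvariant]
  · simp [basicInvariant, x]

theorem isDegrees_explicitDegrees (hr : 0 < r) (hpr : p ∣ r) :
    IsDegrees (G r p (k + 1)) (explicitDegrees r p (k + 1)) := by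
  refine ⟨basicInvariant r p k,
    Fin.cases ((k + 1) * (r / p)) (fun i : Fin k => (i + 1) * r), fun i => ?_,
    basicInvariant_algebraicIndependent hr hpr, ?_, ?_⟩
  · refine Fin.cases ?_ (fun i => ?_) i
    · exact isHomogeneous_prod_X.pow _
    · have := isHomogeneous_expand (r := r) (isHomogeneous_esymm (n := k + 1) (i + 1))
      rwa [mul_comm] at this
  · refine le_antisymm (Algebra.adjoin_le ?_) fun f hf => mem_adjoin_basicInvariant hr hpr hf
    rintro _ ⟨i, rfl⟩
    exact basicInvariant_mem i
  · rw [Fin.univ_succ, Finset.cons_val, Multiset.map_cons, Finset.map_val, Multiset.map_map]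
    refine congrArg₂ Multiset.cons rfl ?_
    rw [Nat.add_sub_cancel, ← Finset.range_val, ← Nat.Iio_eq_range, ← Fin.map_valEmbedding_univ,
      Finset.map_val, Multiset.map_map]
    rfl

end

/-! ### Uniqueness of the degrees -/

section

variable {n : ℕ}

lemma homogeneousComponent_aeval {g : Fin n → Poly n} {d : Fin n → ℕ}
    (hg : ∀ i, (g i).IsHomogeneous (d i)) (N : ℕ) (P : Poly n) :
    homogeneousComponent N (aeval g P) = aeval g (weightedHomogeneousComponent d N P) := by
  induction P using MvPolynomial.induction_on' with
  | monomial u c =>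
    have h1 : (aeval g (monomial u c)).IsHomogeneous (Finsupp.weight d u) := by
      rw [aeval_monomial, algebraMap_eq, Finsupp.weight_apply]
      refine IsHomogeneous.C_mul (IsHomogeneous.prod _ _ _ fun i _ => ?_) c
      dsimp only
      rw [smul_eq_mul, mul_comm]
      exact (hg i).pow (u i)
    have h2 := isWeightedHomogeneous_monomial d u c rfl
    rw [homogeneousComponent_of_mem h1, weightedHomogeneousComponent_of_mem h2]
    split_ifs
    · rfl
    · rw [map_zero]
  | add p q hp hq => rw [map_add, map_add, map_add, map_add, hp, hq]

lemma weight_eq_of_coeff_ne_zero {g : Fin n → Poly n} {d : Fin n → ℕ}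
    (hg : ∀ i, (g i).IsHomogeneous (d i)) (hgi : AlgebraicIndependent ℂ g) {N : ℕ} {P : Poly n}
    (hP : (aeval g P).IsHomogeneous N) {u : Fin n →₀ ℕ} (hu : coeff u P ≠ 0) :
    Finsupp.weight d u = N := by
  by_contra hne
  have h := homogeneousComponent_aeval hg (Finsupp.weight d u) P
  rw [homogeneousComponent_of_mem hP, if_neg hne] at h
  have h0 : weightedHomogeneousComponent d (Finsupp.weight d u) P = 0 :=
    (injective_iff_map_eq_zero _).1 (algebraicIndependent_iff_injective_aeval.1 hgi) _ h.symm
  have := congrArg (coeff u) h0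
  rw [coeff_weightedHomogeneousComponent, if_pos rfl, coeff_zero] at this
  exact hu this

/-- The chain rule at the origin, which P maps to itself by `hP`. -/
lemma constantCoeff_pderiv_bind₁ {P : Fin n → Poly n} (hP : ∀ i, constantCoeff (P i) = 0) (l : Fin n)
    (Q : Poly n) : constantCoeff (pderiv l (bind₁ P Q)) =
      ∑ i, constantCoeff (pderiv i Q) * constantCoeff (pderiv l (P i)) := by
  have hc : ∀ R : Poly n, constantCoeff (bind₁ P R) = constantCoeff R := by
    intro R
    induction R using MvPolynomial.induction_on with
    | C c => simp
    | add p q hp hq => simp [hp, hq]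
    | mul_X p i hp => simp [hP]
  induction Q using MvPolynomial.induction_on with
  | C c => simp
  | add p q hp hq => simp [hp, hq, add_mul, Finset.sum_add_distrib]
  | mul_X p i hp =>
    simp only [map_mul, bind₁_X_right, Derivation.leibniz, smul_eq_mul, map_add, hc, hP, hp,
      constantCoeff_X, zero_mul, add_zero, pderiv_X]
    simp [Pi.single_apply, mul_ite, ite_mul]

lemma coeff_single_of_constantCoeff_pderiv_ne_zero {P : Poly n} {l : Fin n}
    (h : constantCoeff (pderiv l P) ≠ 0) : coeff (Finsupp.single l 1) P ≠ 0 := by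
  contrapose! h
  rw [P.as_sum, map_sum, map_sum]
  refine Finset.sum_eq_zero fun u _ => ?_
  rw [pderiv_monomial, constantCoeff_monomial]
  split_ifs with hu
  · by_cases hul : u l = 0
    · simp [hul]
    · have : u = Finsupp.single l 1 := by
        ext i
        have h1 := DFunLike.congr_fun hu i
        by_cases hi : i = l
        · subst hi
          simp at h1 ⊢
          omega
        · simpa [Finsupp.single_apply, Ne.symm hi] using h1
      rw [this, h, zero_mul]
  · rfl

/-- The degrees of algebraically independent homogeneous generators are unique. -/
theorem IsDegrees.unique {W : Subgroup (GL (Fin n) ℂ)} {D D' : Multiset ℕ} (hD : IsDegrees W D)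
    (hD' : IsDegrees W D') : D = D' := by
  obtain ⟨f, d, hf, hfi, hfW, rfl⟩ := hD
  obtain ⟨g, d', hg, hgi, hgW, rfl⟩ := hD'
  have h1 : ∀ i, ∃ P : Poly n, aeval g P = f i := fun i => by
    have : f i ∈ Algebra.adjoin ℂ (Set.range g) := by
      rw [hgW, ← hfW]
      exact Algebra.subset_adjoin (Set.mem_range_self i)
    rwa [Algebra.adjoin_range_eq_range_aeval] at this
  have h2 : ∀ i, ∃ Q : Poly n, aeval f Q = g i := fun i => by
    have : g i ∈ Algebra.adjoin ℂ (Set.range f) := by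
      rw [hfW, ← hgW]
      exact Algebra.subset_adjoin (Set.mem_range_self i)
    rwa [Algebra.adjoin_range_eq_range_aeval] at this
  choose P hP using h1
  choose Q hQ using h2
  -- A generator of degree zero would be a constant, hence algebraic.
  have hd : ∀ i, d i ≠ 0 := fun i hi => by
    have h := hf i
    rw [hi, ← totalDegree_zero_iff_isHomogeneous, totalDegree_eq_zero_iff_eq_C] at h
    have h3 := hfi.transcendental i
    rw [h] at h3
    exact h3 (isAlgebraic_algebraMap _)
  have hP0 : ∀ i, constantCoeff (P i) = 0 := fun i => by
    by_contra h
    rw [constantCoeff_eq] at h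
    have := weight_eq_of_coeff_ne_zero hg hgi (by rw [hP]; exact hf i) h
    rw [map_zero] at this
    exact hd i this.symm
  have hPQ : ∀ j, bind₁ P (Q j) = X j := fun j => by
    apply algebraicIndependent_iff_injective_aeval.1 hgi
    rw [aeval_bind₁]
    simp only [hP, hQ, aeval_X]
  -- Jacobian matrices at the origin of the two changes of generators; they are mutually inverse.
  let A : Matrix (Fin n) (Fin n) ℂ := Matrix.of fun i l => constantCoeff (pderiv l (P i))
  let B : Matrix (Fin n) (Fin n) ℂ := Matrix.of fun j i => constantCoeff (pderiv i (Q j))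
  have hBA : B * A = 1 := by
    ext j l
    rw [Matrix.mul_apply]
    refine (constantCoeff_pderiv_bind₁ hP0 l (Q j)).symm.trans ?_
    rw [hPQ, pderiv_X, Matrix.one_apply, Pi.single_apply]
    split_ifs <;> simp_all
  have hA : A.det ≠ 0 := fun h => by
    have := congrArg Matrix.det hBA
    rw [Matrix.det_mul, h, mul_zero, Matrix.det_one] at this
    exact zero_ne_one this
  -- A non-zero term of the Leibniz expansion gives a σ such that the variable X_l occurs linearly
  -- in P_(σ l). Comparing weights gives d_(σ l) = d'_l.
  rw [Matrix.det_apply] at hA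
  obtain ⟨σ, -, hσ⟩ := Finset.exists_ne_zero_of_sum_ne_zero hA
  have hdd : ∀ l, d (σ l) = d' l := fun l => by
    have h3 : A (σ l) l ≠ 0 := fun h => hσ (by
      rw [Finset.prod_eq_zero (f := fun i => A (σ i) i) (Finset.mem_univ l) h, smul_zero])
    have := weight_eq_of_coeff_ne_zero hg hgi (by rw [hP]; exact hf (σ l))
      (coeff_single_of_constantCoeff_pderiv_ne_zero h3)
    simpa [Finsupp.weight_single] using this.symm
  rw [← funext hdd, show (fun l => d (σ l)) = d ∘ σ from rfl, ← Multiset.map_map]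
  congr 1
  exact (Multiset.map_univ_val_equiv σ).symm

end

/-! ### Multiplicities in the coinvariant algebra -/

section

variable {n : ℕ} (W : Subgroup (GL (Fin n) ℂ))

lemma homogeneousComponent_polyAct (w : GL (Fin n) ℂ) (N : ℕ) (f : Poly n) :
    homogeneousComponent N (polyAct n w f) = polyAct n w (homogeneousComponent N f) :=
  homogeneousComponent_aeval (d := 1) (fun _ => IsHomogeneous.sum _ _ _ fun j _ => by
    rw [smul_eq_C_mul]
    exact (isHomogeneous_X ℂ j).C_mul _) N f

variable {W}

lemma homogeneousComponent_mem_invariantRing {f : Poly n} (hf : f ∈ invariantRing W) (N : ℕ) :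
    homogeneousComponent N f ∈ invariantRing W := fun w => by
  rw [← homogeneousComponent_polyAct, hf w]

/-- Modulo the Hilbert ideal, only the constant coefficient of an invariant matters. -/
lemma homogeneousComponent_mul_sub_mem {c f : Poly n} (hc : c ∈ invariantRing W) {e : ℕ}
    (hf : f.IsHomogeneous e) (d : ℕ) :
    homogeneousComponent d (c * f) - (if e = d then constantCoeff c else 0) • f ∈
      hilbertIdeal W := by
  have h : c * f = (∑ i ∈ Finset.range c.totalDegree, homogeneousComponent (i + 1) c * f) +
      homogeneousComponent 0 c * f := by
    rw [← Finset.sum_mul, ← add_mul, ← Finset.sum_range_succ' (fun i => homogeneousComponent i c),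
      sum_homogeneousComponent]
  rw [h, map_add, map_sum, add_sub_assoc]
  refine add_mem (sum_mem fun N _ => ?_) ?_
  · rw [homogeneousComponent_of_mem ((homogeneousComponent_isHomogeneous (N + 1) c).mul hf)]
    split_ifs
    · exact Ideal.mul_mem_right _ _ (Ideal.subset_span
        ⟨homogeneousComponent_mem_invariantRing hc _, N + 1, N.succ_pos,
          homogeneousComponent_isHomogeneous _ _⟩)
    · exact zero_mem _
  · rw [homogeneousComponent_zero, ← smul_eq_C_mul, map_smul, homogeneousComponent_of_mem hf,
      constantCoeff_eq]
    by_cases h : e = d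
    · rw [if_pos h, if_pos h.symm, sub_self]
      exact zero_mem _
    · rw [if_neg h, if_neg (Ne.symm h), smul_zero, zero_smul, sub_zero]
      exact zero_mem _

variable {V : Type*} [AddCommGroup V] [Module ℂ V] (ρ : Representation ℂ W V)

/-- `F` is an intertwining map from `V` to the polynomials. -/
def IsEquivariant (F : V →ₗ[ℂ] Poly n) : Prop :=
  ∀ (w : W) v, F (ρ w v) = polyAct n w (F v)

variable [Fintype W]

/-- The average over `W` of a linear map from `V` to the polynomials. -/
def reynolds : (V →ₗ[ℂ] Poly n) →ₗ[ℂ] V →ₗ[ℂ] Poly n where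
  toFun F := (Fintype.card W : ℂ)⁻¹ •
    ∑ w : W, (polyAct n (w : GL (Fin n) ℂ)).toLinearMap ∘ₗ F ∘ₗ ρ w⁻¹
  map_add' F F' := by
    simp only [LinearMap.add_comp, LinearMap.comp_add, Finset.sum_add_distrib, smul_add]
  map_smul' c F := by
    simp only [LinearMap.smul_comp, LinearMap.comp_smul, ← Finset.smul_sum, RingHom.id_apply]
    rw [smul_comm]

lemma reynolds_apply (F : V →ₗ[ℂ] Poly n) (v : V) : reynolds ρ F v =
    (Fintype.card W : ℂ)⁻¹ • ∑ w : W, polyAct n (w : GL (Fin n) ℂ) (F (ρ w⁻¹ v)) := by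
  simp [reynolds]

lemma reynolds_isEquivariant (F : V →ₗ[ℂ] Poly n) : IsEquivariant ρ (reynolds ρ F) := by
  intro h v
  rw [reynolds_apply, reynolds_apply, map_smul, map_sum]
  congr 1
  refine (Fintype.sum_equiv (Equiv.mulLeft h) _ _ fun w => ?_).symm
  rw [Equiv.coe_mulLeft, Subgroup.coe_mul, map_mul, AlgHom.mul_apply, mul_inv_rev, map_mul,
    Module.End.mul_apply, Representation.inv_self_apply]

lemma card_ne_zero_complex : (Fintype.card W : ℂ) ≠ 0 := Nat.cast_ne_zero.2 Fintype.card_ne_zero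

variable {ρ}

lemma IsEquivariant.reynolds_eq {F : V →ₗ[ℂ] Poly n} (hF : IsEquivariant ρ F) :
    reynolds ρ F = F := by
  ext1 v
  rw [reynolds_apply]
  simp only [← hF _ _, Representation.self_inv_apply]
  rw [Finset.sum_const, Finset.card_univ, ← Nat.cast_smul_eq_nsmul ℂ, smul_smul,
    inv_mul_cancel₀ card_ne_zero_complex, one_smul]

lemma reynolds_mul_apply {s : Poly n} (hs : s ∈ invariantRing W) (F : V →ₗ[ℂ] Poly n) (v : V) :
    reynolds ρ (LinearMap.mulLeft ℂ s ∘ₗ F) v = s * reynolds ρ F v := by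
  rw [reynolds_apply, reynolds_apply, mul_smul_comm, Finset.mul_sum]
  congr 1
  refine Finset.sum_congr rfl fun w _ => ?_
  rw [LinearMap.comp_apply, LinearMap.mulLeft_apply, map_mul, hs w]

variable {ι : Type*} [Fintype ι] {Ω : ι → V →ₗ[ℂ] Poly n} {e : ι → ℕ}

/-- F is its own average and a sum of rank-one maps with values in J. Averaging ℓ ⊗ ag, with g a
positive-degree invariant, gives g times the average of ℓ ⊗ a. Expanding the latter in the Ω i
yields coefficients g c_i without constant term. -/
lemma exists_constantCoeff_eq_zero_of_mem_hilbertIdeal [FiniteDimensional ℂ V]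
    (hspan : ∀ F : V →ₗ[ℂ] Poly n, IsEquivariant ρ F → ∃ c : ι → Poly n,
      (∀ i, c i ∈ invariantRing W) ∧ ∀ v, F v = ∑ i, c i * Ω i v)
    {F : V →ₗ[ℂ] Poly n} (hF : IsEquivariant ρ F) (hJ : ∀ v, F v ∈ hilbertIdeal W) :
    ∃ c : ι → Poly n, (∀ i, constantCoeff (c i) = 0) ∧ ∀ v, F v = ∑ i, c i * Ω i v := by
  let N : Submodule ℂ (V →ₗ[ℂ] Poly n) :=
    { carrier := {F | ∃ c : ι → Poly n, (∀ i, constantCoeff (c i) = 0) ∧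
        ∀ v, F v = ∑ i, c i * Ω i v}
      add_mem' := by
        rintro F F' ⟨c, hc, h⟩ ⟨c', hc', h'⟩
        refine ⟨c + c', fun i => by simp [hc, hc'], fun v => ?_⟩
        simp only [LinearMap.add_apply, h, h', Pi.add_apply, add_mul, Finset.sum_add_distrib]
      zero_mem' := ⟨0, by simp, by simp⟩
      smul_mem' := by
        rintro a F ⟨c, hc, h⟩
        refine ⟨a • c, fun i => by simp [smul_eq_C_mul, hc], fun v => ?_⟩
        simp only [LinearMap.smul_apply, h, Pi.smul_apply, smul_mul_assoc, Finset.smul_sum] }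
  -- The free factor a absorbs the ring multiplications in the induction over the ideal.
  have key : ∀ s ∈ hilbertIdeal W, ∀ (ℓ : Module.Dual ℂ V) (a : Poly n),
      reynolds ρ (ℓ.smulRight (a * s)) ∈ N := by
    intro s hs
    induction hs using Submodule.span_induction with
    | mem g hg =>
      intro ℓ a
      obtain ⟨hgW, d, hd, hgd⟩ := hg
      obtain ⟨c, hc, h⟩ := hspan _ (reynolds_isEquivariant ρ (ℓ.smulRight a))
      refine ⟨fun i => g * c i, fun i => ?_, fun v => ?_⟩
      · rw [map_mul, constantCoeff_eq, hgd.coeff_eq_zero (by simpa using hd.ne), zero_mul]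
      · have h1 : ℓ.smulRight (a * g) = LinearMap.mulLeft ℂ g ∘ₗ ℓ.smulRight a := by
          ext1 v
          simp only [LinearMap.smulRight_apply, LinearMap.comp_apply, LinearMap.mulLeft_apply,
            mul_smul_comm]
          rw [mul_comm]
        rw [h1, reynolds_mul_apply hgW, h, Finset.mul_sum]
        exact Finset.sum_congr rfl fun i _ => (mul_assoc _ _ _).symm
    | zero =>
      intro ℓ a
      rw [mul_zero, LinearMap.smulRight_zero, map_zero]
      exact N.zero_mem
    | add x y _ _ hx hy =>
      intro ℓ a
      have h1 : ℓ.smulRight (a * (x + y)) = ℓ.smulRight (a * x) + ℓ.smulRight (a * y) := by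
        ext1 v
        simp [mul_add, smul_add]
      rw [h1, map_add]
      exact N.add_mem (hx ℓ a) (hy ℓ a)
    | smul b x _ hx =>
      intro ℓ a
      rw [smul_eq_mul, ← mul_assoc]
      exact hx ℓ _
  have hsum : F = ∑ j, ((Module.finBasis ℂ V).coord j).smulRight
      (1 * F (Module.finBasis ℂ V j)) := by
    ext1 v
    conv_lhs => rw [← (Module.finBasis ℂ V).sum_repr v, map_sum]
    simp
  have hFN : reynolds ρ F ∈ N := by
    rw [hsum, map_sum]
    exact N.sum_mem fun j _ => key _ (hJ _) _ 1
  rw [hF.reynolds_eq] at hFN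
  exact hFN

lemma sum_subtype_eq_sum_ite {E : Type*} [AddCommMonoid E] [Module ℂ E] (P : ι → Prop)
    [DecidablePred P] (c : ι → ℂ) (f : ι → E) :
    ∑ i : {i // P i}, c i • f i = ∑ i, (if P i then c i else 0) • f i := by
  simp only [ite_smul, zero_smul]
  rw [← Finset.sum_filter, Finset.sum_subtype (p := P) _ (by simp)]

/-- The multiplicities of `V` in the coinvariant algebra are given by the degrees of a homogeneous
basis of the equivariant maps from `V` to the polynomials. -/
theorem coinvMult_eq_card [FiniteDimensional ℂ V] (hΩ : ∀ i, IsEquivariant ρ (Ω i))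
    (hdeg : ∀ i v, (Ω i v).IsHomogeneous (e i))
    (hspan : ∀ F : V →ₗ[ℂ] Poly n, IsEquivariant ρ F → ∃ c : ι → Poly n,
      (∀ i, c i ∈ invariantRing W) ∧ ∀ v, F v = ∑ i, c i * Ω i v)
    (hli : ∀ c : ι → Poly n, (∀ v, ∑ i, c i * Ω i v = 0) → c = 0) (d : ℕ) :
    coinvMult W ρ d = Fintype.card {i // e i = d} := by
  classical
  set J := (hilbertIdeal W).restrictScalars ℂ
  let φ : {i // e i = d} → Representation.IntertwiningMap ρ (coinvPiece W d).toRepresentation :=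
    fun i => LinearMap.intertwiningMap_of_isIntertwiningMap ρ (coinvPiece W d).toRepresentation
      ((J.mkQ ∘ₗ Ω i).codRestrict (coinvPiece W d).toSubmodule
        fun v => ⟨Ω i v, by have := hdeg i v; rwa [i.2] at this, rfl⟩)
      fun w v => Subtype.ext (congrArg J.mkQ (hΩ i w v))
  have hφ : ∀ (c : {i // e i = d} → ℂ) v, (((∑ i, c i • φ i) v :
      (coinvPiece W d).toSubmodule) : Poly n ⧸ J) = J.mkQ (∑ i, c i • Ω i v) := by
    intro c v
    rw [Representation.IntertwiningMap.sum_apply, map_sum, AddSubmonoidClass.coe_finsetSum]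
    refine Finset.sum_congr rfl fun i _ => ?_
    rw [map_smul]
    rfl
  have hinj : ∀ c : {i // e i = d} → ℂ, (∀ v, J.mkQ (∑ i, c i • Ω i v) = 0) → c = 0 := by
    intro c hc
    obtain ⟨c, rfl⟩ : ∃ c₁ : ι → ℂ, c = fun i : {i // e i = d} => c₁ i :=
      ⟨fun i => if h : e i = d then c ⟨i, h⟩ else 0, by ext i; simp [i.2]⟩
    have hmem : ∀ v, (∑ i : {i // e i = d}, c i • Ω i) v ∈ hilbertIdeal W := by
      intro v
      have h := (Submodule.Quotient.mk_eq_zero J).1 (hc v)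
      rw [LinearMap.sum_apply]
      exact h
    have heq : IsEquivariant ρ (∑ i : {i // e i = d}, c i • Ω i) := by
      intro w v
      simp [hΩ _ w v]
    obtain ⟨c', hc', h'⟩ := exists_constantCoeff_eq_zero_of_mem_hilbertIdeal hspan heq hmem
    -- Two expansions of the same map, one with constant coefficients and one without constant
    -- terms; by independence they agree, so the constants vanish.
    have h0 := hli (fun i => C (if e i = d then c i else 0) - c' i) fun v => by
      simp only [sub_mul, Finset.sum_sub_distrib, ← h', sub_eq_zero]
      rw [LinearMap.sum_apply]
      refine .trans ?_ (sum_subtype_eq_sum_ite (fun i => e i = d) c fun i => Ω i v).symm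
      simp only [smul_eq_C_mul]
    ext i
    have h1 := congrArg constantCoeff (congrFun h0 i)
    simpa [hc', i.2] using h1
  have hind : LinearIndependent ℂ φ := by
    refine Fintype.linearIndependent_iffₛ.2 fun c c' h i => ?_
    refine sub_eq_zero.1 (congrFun (hinj (c - c') fun v => ?_) i)
    simp only [Pi.sub_apply, sub_smul, Finset.sum_sub_distrib]
    rw [LinearMap.map_sub, ← hφ, ← hφ, h, sub_self]
  have hsp : ⊤ ≤ Submodule.span ℂ (Set.range φ) := by
    intro ψ _
    -- A linear section of the projection lifts ψ to polynomials of degree d. Averaging makes the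
    -- lift equivariant and does not change its class modulo J, since ψ is already equivariant.
    let π : homogeneousSubmodule (Fin n) ℂ d →ₗ[ℂ] (coinvPiece W d).toSubmodule :=
      J.mkQ.restrict fun f hf => ⟨f, hf, rfl⟩
    have hπ : Function.Surjective π := by
      rintro ⟨_, f, hf, rfl⟩
      exact ⟨⟨f, hf⟩, rfl⟩
    obtain ⟨s, hs⟩ := π.exists_rightInverse_of_surjective (LinearMap.range_eq_top.2 hπ)
    let F₀ : V →ₗ[ℂ] Poly n := (homogeneousSubmodule (Fin n) ℂ d).subtype ∘ₗ s ∘ₗ ψ.toLinearMap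
    have hF₀ : ∀ v, J.mkQ (F₀ v) = (ψ v : Poly n ⧸ J) := fun v =>
      congrArg Subtype.val (LinearMap.congr_fun hs (ψ v))
    have hF₀d : ∀ v, (F₀ v).IsHomogeneous d := fun v => (s (ψ v)).2
    let F := reynolds ρ F₀
    have hFd : ∀ v, (F v).IsHomogeneous d := fun v => by
      simp only [F, reynolds_apply]
      exact Submodule.smul_mem (homogeneousSubmodule (Fin n) ℂ d) _
        (Submodule.sum_mem _ fun w _ => isHomogeneous_polyAct _ (hF₀d _))
    have hF : ∀ v, J.mkQ (F v) = (ψ v : Poly n ⧸ J) := fun v => by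
      simp only [F, reynolds_apply, map_smul, map_sum]
      have h1 : ∀ w : W, J.mkQ (polyAct n (w : GL (Fin n) ℂ) (F₀ (ρ w⁻¹ v))) = ψ v := by
        intro w
        have h2 : J.mkQ (polyAct n (w : GL (Fin n) ℂ) (F₀ (ρ w⁻¹ v))) =
            coinvRep W w (J.mkQ (F₀ (ρ w⁻¹ v))) := rfl
        have h3 := Representation.IntertwiningMap.isIntertwining _ _ ψ w (ρ w⁻¹ v)
        rw [Representation.self_inv_apply] at h3
        rw [h2, hF₀, h3]
        rfl
      rw [Finset.sum_congr rfl fun w _ => h1 w, Finset.sum_const, Finset.card_univ,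
        ← Nat.cast_smul_eq_nsmul ℂ, smul_smul, inv_mul_cancel₀ card_ne_zero_complex, one_smul]
    obtain ⟨c, hc, hcF⟩ := hspan F (reynolds_isEquivariant ρ F₀)
    rw [Submodule.mem_span_range_iff_exists_fun]
    refine ⟨fun i => constantCoeff (c i), ?_⟩
    apply Representation.IntertwiningMap.ext
    ext1 v
    apply Subtype.ext
    refine (hφ _ v).trans ?_
    change _ = ((ψ v : (coinvPiece W d).toSubmodule) : Poly n ⧸ J)
    rw [← hF v, ← homogeneousComponent_eq_self (hFd v), hcF]
    refine ((Submodule.Quotient.eq J).2 ?_).symm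
    rw [map_sum, sum_subtype_eq_sum_ite (fun i => e i = d) (fun i => constantCoeff (c i))
      fun i => Ω i v, ← Finset.sum_sub_distrib]
    exact Submodule.sum_mem _ fun i _ => homogeneousComponent_mul_sub_mem (hc i) (hdeg i v) d
  rw [coinvMult, Module.finrank_eq_card_basis (Module.Basis.mk hind hsp)]

end

/-! ### Exponents of V and their duality with the degrees -/

section

variable {r p n m k : ℕ}

/-- All matrix entries lie in the finite set consisting of 0 and the r-th roots of unity. Finiteness
is what permits averaging. -/
lemma finite_G (hr : 0 < r) : Finite (G r p n) := by
  let T : Finset ℂ := insert 0 (Polynomial.nthRootsFinset r (1 : ℂ))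
  have hT : ∀ (w : G r p n) i j, ((w : GL (Fin n) ℂ) : Matrix (Fin n) (Fin n) ℂ) i j ∈ T := by
    rintro ⟨w, σ, a, ha, -, hw⟩ i j
    rw [hw, Finset.mem_insert, Polynomial.mem_nthRootsFinset hr]
    split_ifs
    · exact Or.inr (by simpa using congrArg Units.val (ha j))
    · exact Or.inl rfl
  refine Finite.of_injective (fun (w : G r p n) i j => (⟨_, hT w i j⟩ : T)) fun w v h => ?_
  apply Subtype.ext
  apply Units.ext
  ext i j
  exact congrArg Subtype.val (congrFun (congrFun h i) j)

lemma isEquivariant_constr_covMatrix (hr : 0 < r) (hpr : p ∣ r) (hm : m ≠ 0) (i : Fin (k + 1)) :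
    IsEquivariant (powerRep r p (k + 1) m).toRepresentation
      ((powerBasis r p (k + 1) hm).constr ℂ (covMatrix r p m k i)) := by
  intro w
  suffices h : ((powerBasis r p (k + 1) hm).constr ℂ (covMatrix r p m k i)) ∘ₗ
      (powerRep r p (k + 1) m).toRepresentation w = (polyAct (k + 1) w).toLinearMap ∘ₗ
        ((powerBasis r p (k + 1) hm).constr ℂ (covMatrix r p m k i)) from
    fun v => LinearMap.congr_fun h v
  refine (powerBasis r p (k + 1) hm).ext fun j => ?_
  obtain ⟨σ, a, ha, hact⟩ := exists_actsMonomially w.2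
  rw [LinearMap.comp_apply, LinearMap.comp_apply, powerRep_apply_powerBasis hm w hact, map_smul,
    Module.Basis.constr_basis, Module.Basis.constr_basis, AlgHom.toLinearMap_apply,
    covMatrix_isCovariant hr hpr i w w.2 σ a ha hact]

lemma IsEquivariant.isCovariant (hm : m ≠ 0) {F : (powerRep r p n m).toSubmodule →ₗ[ℂ] Poly n}
    (hF : IsEquivariant (powerRep r p n m).toRepresentation F) :
    IsCovariant r p m fun j => F (powerBasis r p n hm j) := by
  intro w hw σ a _ hact j
  have h := hF ⟨w, hw⟩ (powerBasis r p n hm j)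
  rw [powerRep_apply_powerBasis hm ⟨w, hw⟩ hact, map_smul] at h
  exact h.symm

lemma coinvMult_powerRep (hr : 0 < r) (hpr : p ∣ r) (hm : m ≠ 0) (d : ℕ) :
    coinvMult (G r p (k + 1)) (powerRep r p (k + 1) m).toRepresentation d =
      Fintype.card {i // covDegree r p m k i = d} := by
  have := finite_G (p := p) (n := k + 1) hr
  have := Fintype.ofFinite (G r p (k + 1))
  set b := powerBasis r p (k + 1) hm
  have : FiniteDimensional ℂ (powerRep r p (k + 1) m).toSubmodule := b.finiteDimensional_of_finite
  have hΩ : ∀ i v, b.constr ℂ (covMatrix r p m k i) v =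
      ∑ j, b.repr v j • covMatrix r p m k i j := fun i v => by
    rw [Module.Basis.constr_apply_fintype]
    rfl
  refine coinvMult_eq_card (Ω := fun i => b.constr ℂ (covMatrix r p m k i))
    (isEquivariant_constr_covMatrix hr hpr hm) (fun i v => ?_) (fun F hF => ?_) (fun c hc => ?_) d
  · rw [hΩ]
    exact Submodule.sum_mem (homogeneousSubmodule (Fin (k + 1)) ℂ _) fun j _ =>
      Submodule.smul_mem _ _ (covMatrix_isHomogeneous i j)
  · obtain ⟨c, hc, h⟩ := (hF.isCovariant hm).exists_eq_sum hr hpr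
    refine ⟨c, hc, fun v => ?_⟩
    conv_lhs => rw [← b.sum_repr v, map_sum]
    simp only [hΩ, map_smul, Finset.mul_sum]
    rw [Finset.sum_comm]
    refine Finset.sum_congr rfl fun j _ => ?_
    rw [h j, Finset.smul_sum]
    exact Finset.sum_congr rfl fun i _ => (mul_smul_comm _ _ _).symm
  · refine covMatrix_linearIndependent (p := p) (m := m) hr fun j => ?_
    have h := hc (b j)
    simpa only [Module.Basis.constr_basis] using h

lemma coeff_sum_X_pow (E : Multiset ℕ) (d : ℕ) :
    PowerSeries.coeff d (E.map fun e => (PowerSeries.X : PowerSeries ℕ) ^ e).sum = E.count d := by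
  induction E using Multiset.induction_on with
  | empty => simp
  | cons a E ih =>
    rw [Multiset.map_cons, Multiset.sum_cons, map_add, ih, PowerSeries.coeff_X_pow,
      Multiset.count_cons, add_comm]

lemma isExponents_iff {W : Subgroup (GL (Fin n) ℂ)} {V : Type*} [AddCommGroup V] [Module ℂ V]
    {ρ : Representation ℂ W V} {E : Multiset ℕ} :
    IsExponents W ρ E ↔ ∀ d, coinvMult W ρ d = E.count d := by
  rw [IsExponents, PowerSeries.ext_iff]
  simp only [PowerSeries.coeff_mk, coeff_sum_X_pow]

theorem isExponents_powerRep (hr : 0 < r) (hpr : p ∣ r) (hm : m ≠ 0) :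
    IsExponents (G r p (k + 1)) (powerRep r p (k + 1) m).toRepresentation
      (explicitExponents r p (k + 1) m) := by
  rw [isExponents_iff, explicitExponents_eq hr]
  intro d
  rw [coinvMult_powerRep hr hpr hm, Multiset.count_map, Fintype.card_subtype, Finset.card_def,
    Finset.filter_val]
  simp only [eq_comm]

lemma map_range_reflect {α : Type*} (N : ℕ) (f : ℕ → α) :
    (Multiset.range N).map (fun i => f (N - 1 - i)) = (Multiset.range N).map f := by
  have h : ∀ g : ℕ → α, (Multiset.range N).map g =
      Multiset.map (fun i : Fin N => g (i : ℕ)) Finset.univ.val := by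
    intro g
    rw [← Finset.range_val, ← Nat.Iio_eq_range, ← Fin.map_valEmbedding_univ, Finset.map_val,
      Multiset.map_map]
    rfl
  rw [h f, h]
  conv_rhs => rw [← Multiset.map_univ_val_equiv (Fin.revPerm (n := N)), Multiset.map_map]
  refine congrArg₂ Multiset.map (funext fun i => ?_) rfl
  simp only [Function.comp_apply, Fin.revPerm_apply, Fin.val_rev]
  congr 1
  omega

lemma map_range_sub (N c r : ℕ) :
    ((Multiset.range N).map fun i => c + i * r).map
        (fun e : ℕ => ((N * r + c : ℕ) : ℤ) - (e : ℤ)) =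
      ((Multiset.range N).map fun i => (i + 1) * r).map fun d : ℕ => (d : ℤ) := by
  rw [Multiset.map_map, Multiset.map_map, ← map_range_reflect]
  refine Multiset.map_congr rfl fun i hi => ?_
  rw [Multiset.mem_range] at hi
  obtain ⟨l, rfl⟩ : ∃ l, N = i + 1 + l := ⟨N - (i + 1), by omega⟩
  rw [show i + 1 + l - 1 - i = l by omega]
  simp only [Function.comp_apply]
  push_cast
  ring

lemma explicitExponents_duality (hr : 1 < r) (hpr : p ∣ r)
    (hm : m = coxeterNumber r p (k + 1) + 1) :
    (explicitExponents r p (k + 1) m).map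
        (fun e : ℕ => (coxeterNumber r p (k + 1) : ℤ) + 1 - (e : ℤ)) =
      (explicitDegrees r p (k + 1)).map fun d : ℕ => (d : ℤ) := by
  have hmz : (coxeterNumber r p (k + 1) : ℤ) + 1 = ((m : ℕ) : ℤ) := by rw [hm]; push_cast; rfl
  rw [hmz]
  have hp0 : 0 < p := Nat.pos_of_dvd_of_pos hpr (by omega)
  have hple := Nat.le_of_dvd (by omega) hpr
  rw [coxeterNumber, Nat.add_sub_cancel] at hm
  by_cases hp : p = 1
  · subst hp
    rw [if_pos hr, Nat.div_one] at hm
    have hmr : m % r = 1 := by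
      rw [hm, add_assoc, Nat.mul_add_mod, Nat.add_mod_left, Nat.mod_eq_of_lt hr]
    have hD : explicitDegrees r 1 (k + 1) = (Multiset.range (k + 1)).map fun i => (i + 1) * r := by
      rw [explicitDegrees, Nat.div_one, Nat.add_sub_cancel, Multiset.range_succ, Multiset.map_cons]
    rw [hD, explicitExponents, if_pos rfl, hmr, ← map_range_sub (k + 1) 1 r]
    refine Multiset.map_congr rfl fun e _ => ?_
    rw [hm]
    push_cast
    ring
  · obtain ⟨q, hq⟩ := hpr
    have hdiv : r / p = q := by rw [hq, Nat.mul_div_cancel_left _ hp0]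
    have hq0 : 0 < q := Nat.pos_of_ne_zero fun h => by simp [h] at hq; omega
    -- The first identity pairs the exponents m̄ + ir with the degrees r, …, kr; the second pairs
    -- the last exponent with (k + 1) r/p. For p < r one has m̄ = q + 1 and m' = 1; for p = r, m̄ =
    -- 1 and m' = 0.
    have key : m = k * r + m % r ∧
        (k + 1) * q + (k * (r - m % r) + (k + 1) * (m % q)) = m := by
      by_cases hpr' : p < r
      · have hq2 : 2 ≤ q := by
          by_contra h
          have : q = 1 := by omega
          rw [this, mul_one] at hq
          omega
        have hlt : q + 1 < r := by
          have : 2 * q ≤ p * q := Nat.mul_le_mul_right q (by omega)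
          omega
        rw [if_pos hpr', hdiv] at hm
        have h1 : m % r = q + 1 := by
          rw [hm, add_assoc, Nat.mul_add_mod, Nat.mod_eq_of_lt hlt]
        have h2 : m % q = 1 := by
          rw [← Nat.mod_mod_of_dvd m (Dvd.intro_left p hq.symm), h1, Nat.add_mod_left,
            Nat.mod_eq_of_lt (by omega)]
        rw [h1, h2, hm]
        obtain ⟨s, hs⟩ := Nat.exists_eq_add_of_lt hlt
        refine ⟨by ring, ?_⟩
        rw [show r - (q + 1) = s + 1 by omega, hs]
        ring
      · have hpr'' : p = r := by omega
        have hq1 : q = 1 := by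
          rw [hpr''] at hq
          exact (Nat.mul_eq_left (by omega)).1 hq.symm
        rw [if_neg hpr'] at hm
        have h1 : m % r = 1 := by
          rw [hm, Nat.mul_add_mod, Nat.mod_eq_of_lt hr]
        rw [h1, hq1, Nat.mod_one, hm]
        obtain ⟨s, hs⟩ := Nat.exists_eq_add_of_lt hr
        refine ⟨by ring, ?_⟩
        rw [show r - 1 = s + 1 by omega, hs]
        ring
    rw [explicitExponents, if_neg hp, explicitDegrees, hdiv, Nat.add_sub_cancel, Multiset.map_cons,
      Multiset.map_cons, ← map_range_sub k (m % r) r, ← key.1]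
    congr 1
    have := key.2
    zify at this
    push_cast
    linarith

end

end ReflRep
end

theorem mainTheorem10 (r p n m : ℕ) (hr : 1 < r) (hpr : p ∣ r) (hn : 1 ≤ n) (hm : ¬ r ∣ m) :
    -- `V = ℂ{x_1^m, …, x_n^m}` is irreducible, apart from the degenerate cases in rank two
    (¬ (n = 2 ∧ Even p ∧ r ∣ 2 * m) →
      (ReflRep.powerRep r p n m).toRepresentation.IsIrreducible) ∧
    -- `V` is free
    ReflRep.IsFreeRep (ReflRep.G r p n) (ReflRep.powerRep r p n m).toRepresentation ∧
    -- the exponents of `V`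
    ReflRep.IsExponents (ReflRep.G r p n) (ReflRep.powerRep r p n m).toRepresentation
      (ReflRep.explicitExponents r p n m) ∧
    -- the degrees of `G(r,p,n)`
    ReflRep.IsDegrees (ReflRep.G r p n) (ReflRep.explicitDegrees r p n) ∧
    -- if `m = h + 1`, then `{h + 1 - e_i} = {d_i}`
    (m = ReflRep.coxeterNumber r p n + 1 → ∀ E D : Multiset ℕ,
      ReflRep.IsExponents (ReflRep.G r p n) (ReflRep.powerRep r p n m).toRepresentation E →
      ReflRep.IsDegrees (ReflRep.G r p n) D →
      E.map (fun e : ℕ => (ReflRep.coxeterNumber r p n : ℤ) + 1 - (e : ℤ)) =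
        D.map (fun d : ℕ => (d : ℤ))) := by
  have hr0 : 0 < r := by omega
  have hm0 : m ≠ 0 := fun h => hm (h ▸ dvd_zero r)
  obtain ⟨k, rfl⟩ : ∃ k, n = k + 1 := ⟨n - 1, by omega⟩
  have hE := ReflRep.isExponents_powerRep (k := k) hr0 hpr hm0
  have hD := ReflRep.isDegrees_explicitDegrees (k := k) hr0 hpr
  refine ⟨ReflRep.powerRep_isIrreducible hr0 hpr hn hm, ReflRep.powerRep_isFreeRep hr0 hpr hm0,
    hE, hD, fun hh E D hE' hD' => ?_⟩
  have h1 : E = ReflRep.explicitExponents r p (k + 1) m := by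
    rw [ReflRep.isExponents_iff] at hE hE'
    exact Multiset.ext.2 fun d => (hE' d).symm.trans (hE d)
  rw [h1, hD'.unique hD]
  exact ReflRep.explicitExponents_duality hr hpr hh
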